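/- **Setting.** Let $T\ge 0$, let $(\Omega,\mathcal F_T,(\mathcal F_t)_{t\in[0,T]},P)$ be a filtered probability space and $S$ an $\mathbb R^d$-valued semimartingale on $[0,T]$. Let $U:\mathbb R\to[-\infty,\infty)$ be proper, concave, non-decreasing and upper semicontinuous with $U(0)=0$ and $\inf\{x: U(x)>-\infty\}<0<\inf\{x:U(x)=U(\infty)\}$, where $U(\infty)=\lim_{x\to\infty}U(x)$. Put $V(y)=\sup_{x}\{U(x)-xy\}$, $\hat U(x)=-U(-|x|)$ and $\hat V(y)=\sup_x\{xy-\hat U(x)\}$. For a Young function $\Phi$ let $L^{\Phi}=\{X\in L^0(\Omega,\mathcal F_T,P): E[\Phi(\lambda X)]<\infty\text{ for some }\lambda>0\}$, $M^{\Phi}=\{X\in L^0(\Omega,\mathcal F_T,P): E[\Phi(\lambda X)]<\infty\text{ for all }\lambda\ge 0\}$ and $\|X\|_{\Phi}=\inf\{\lambda>0: E[\Phi(X/\lambda)]\le 1\}$. Write $I_f(X)=E[f(X)]$ and $\mathcal D=\{X\in L^{\hat U}: I_U(X)>-\infty\}$. Let $L(S)$ be the set of predictable $S$-integrable processes, $\mathcal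 T=\{H\in L(S):\inf_{t\in[0,T]}H\cdot S_t\in L^{\hat U}\}$, $\mathcal K=\{H\cdot S_T: H\in\mathcal T\}$ and $\mathcal C=(\mathcal K-L^0_+)\cap L^{\hat U}$. Put $$\mathcal C^{*}=\{Y\in M^{\hat V}: E[XY]\le 0\ \text{for all }X\in\mathcal C\},\qquad \mathcal C^{**}=\{X\in L^{\hat U}: E[XY]\le 0\ \text{for all }Y\in\mathcal C^{*}\},$$ and, for $B\in L^{\hat U}$, $u(B)=\sup_{X\in\mathcal C}I_U(B+X)$. **Proposition 4.1.** Assume that $\lim_{x\to-\infty}U(x)/x=\infty$ (case SL). Let $B\in L^{\hat U}$, $(B+\mathcal C)\cap\mathcal D\neq\emptyset$, and $$u(B)=\sup_{X\in\mathcal C}I_U(B+X)=\sup_{X\in\mathcal C^{**}}I_U(B+X).$$ Then there are a sequence $Z_n\in M^{\hat V}$ with $\|Z_n\|_{\hat V}\to 0$ and a sequence $Y_n\in\mathcal C^{*}$ such that $$\lim_{n\to\infty}\bigl\{I_V(Y_n+Z_n)+E[(Y_n+Z_n)B]\bigr\}=u(B),$$ where the limit is taken in $[-\infty,\infty]$.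 -/

import Mathlib

open Set Filter Topology MeasureTheory ProbabilityTheory
open scoped NNReal ENNReal

noncomputable section

/-! ### Utility functions and their conjugates -/

/-- A utility function: proper, concave (convex hypograph), non-decreasing and upper
semicontinuous, with values in `[-∞, ∞)`. -/
structure IsUtility (U : ℝ → EReal) : Prop where
  lt_top : ∀ x, U x < ⊤
  dom_nonempty : ∃ x, U x ≠ ⊥
  concave : Convex ℝ {p : ℝ × ℝ | (p.2 : EReal) ≤ U p.1}
  mono : Monotone U
  usc : UpperSemicontinuous U

/-- The lower bound of the effective domain, as an extended real. -/
def domInf (U : ℝ → EReal) : EReal := sInf (Real.toEReal '' {x : ℝ | U x ≠ ⊥})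

/-- The bliss point `inf {x | U x = U(∞)}`, where `U(∞) = sup U` (it is `⊤` if the supremum is not
attained). -/
def blissPoint (U : ℝ → EReal) : EReal := sInf (Real.toEReal '' {x : ℝ | U x = ⨆ y : ℝ, U y})

/-- The normalization: the lower bound of the domain is negative, the bliss point is positive and
`U 0 = 0`. -/
structure IsNormalizedUtility (U : ℝ → EReal) : Prop extends IsUtility U where
  domInf_neg : domInf U < 0
  bliss_pos : 0 < blissPoint U
  map_zero : U 0 = 0

/-- Superlinear left tail: `U x / x → ∞` as `x → -∞`. This includes utilities that are `-∞` far to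
the left (there `⊥ / x = ⊤` for `x < 0`). -/
def IsSuperlinear (U : ℝ → EReal) : Prop :=
  Tendsto (fun x : ℝ => U x / (x : EReal)) atBot (𝓝 ⊤)

/-- The concave conjugate `U^*(y) = inf_x (x y - U x)`. -/
def concaveConj (U : ℝ → EReal) (y : ℝ) : EReal := ⨅ x : ℝ, ((x * y : ℝ) : EReal) - U x

/-- `V = -U^*`. -/
def dualUtility (U : ℝ → EReal) (y : ℝ) : EReal := -concaveConj U y

/-- The Young function `x ↦ -U (-|x|)`; it is `[0, ∞]`-valued because `U 0 = 0` and `U` is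
non-decreasing. -/
def youngU (U : ℝ → EReal) (x : ℝ) : ℝ≥0∞ := (-U (-|x|)).toENNReal

/-- The convex conjugate `y ↦ sup_x (x y - Φ x)` of a Young function; it is non-negative because
`Φ 0 = 0`. -/
def youngConj (Φ : ℝ → ℝ≥0∞) (y : ℝ) : ℝ≥0∞ :=
  (⨆ x : ℝ, ((x * y : ℝ) : EReal) - (Φ x : EReal)).toENNReal

/-- The conjugate Young function of `youngU U`. -/
def youngV (U : ℝ → EReal) : ℝ → ℝ≥0∞ := youngConj (youngU U)

/-! ### Orlicz spaces and expectations -/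

section Orlicz

variable {Ω : Type*} {mΩ : MeasurableSpace Ω}

/-- Membership in the Orlicz space of `Φ`. -/
def MemOrlicz (Φ : ℝ → ℝ≥0∞) (P : Measure Ω) (X : Ω → ℝ) : Prop :=
  AEMeasurable X P ∧ ∃ c : ℝ, 0 < c ∧ ∫⁻ ω, Φ (c * X ω) ∂P < ⊤

/-- Membership in the Orlicz heart of `Φ`. -/
def MemHeart (Φ : ℝ → ℝ≥0∞) (P : Measure Ω) (X : Ω → ℝ) : Prop :=
  AEMeasurable X P ∧ ∀ c : ℝ, 0 ≤ c → ∫⁻ ω, Φ (c * X ω) ∂P < ⊤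

/-- The Minkowski gauge (Luxemburg) norm. -/
def gaugeNorm (Φ : ℝ → ℝ≥0∞) (P : Measure Ω) (X : Ω → ℝ) : ℝ :=
  sInf {c : ℝ | 0 < c ∧ ∫⁻ ω, Φ (X ω / c) ∂P ≤ 1}

/-- Expectation of an extended-real random variable, `E[ξ⁺] - E[ξ⁻]`. Below it is only used where
one of the two parts has finite expectation. -/
def eExp (P : Measure Ω) (ξ : Ω → EReal) : EReal :=
  ((∫⁻ ω, (ξ ω).toENNReal ∂P : ℝ≥0∞) : EReal) - ((∫⁻ ω, (-ξ ω).toENNReal ∂P : ℝ≥0∞) : EReal)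

/-- The integral functional `I_f(X) = E[f(X)]`. -/
def intFun (P : Measure Ω) (f : ℝ → EReal) (X : Ω → ℝ) : EReal := eExp P (fun ω => f (X ω))

/-- The effective domain of expected utility on the Orlicz space. -/
def utilDom (P : Measure Ω) (U : ℝ → EReal) : Set (Ω → ℝ) :=
  {X | MemOrlicz (youngU U) P X ∧ intFun P U X ≠ ⊥}

/-- The polar cone of `C`, a subset of the Orlicz space of `youngU U`, in the Orlicz heart of
`youngV U`, with respect to the pairing `E[X Y]`. -/
def polarCone (P : Measure Ω) (U : ℝ → EReal) (C : Set (Ω → ℝ)) : Set (Ω → ℝ) :=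
  {Y | MemHeart (youngV U) P Y ∧ ∀ X ∈ C, ∫ ω, X ω * Y ω ∂P ≤ 0}

/-- The bipolar cone, back in the Orlicz space; for a convex cone `C` it is the weak-star closure of
`C`. -/
def bipolarCone (P : Measure Ω) (U : ℝ → EReal) (C : Set (Ω → ℝ)) : Set (Ω → ℝ) :=
  {X | MemOrlicz (youngU U) P X ∧ ∀ Y ∈ polarCone P U C, ∫ ω, X ω * Y ω ∂P ≤ 0}

/-- Maximal expected utility `sup_{X ∈ C} I_U(B + X)`. -/
def maxUtility (P : Measure Ω) (U : ℝ → EReal) (C : Set (Ω → ℝ)) (B : Ω → ℝ) : EReal :=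
  ⨆ X ∈ C, intFun P U (B + X)

end Orlicz

/-! ### Semimartingales and stochastic integrals on `[0, T]`

The time interval `[0, T]` is the type `Set.Iic T` with `T : ℝ≥0`; `⊥` is time `0` and `⊤` is time
`T`. -/

section Market

variable {Ω : Type*} {mΩ : MeasurableSpace Ω} {T : ℝ≥0}

/-- Right-continuous with left limits. -/
def IsCadlagPath (f : Iic T → ℝ) : Prop :=
  ∀ t, ContinuousWithinAt f (Ici t) t ∧ ∃ l, Tendsto f (𝓝[<] t) (𝓝 l)

/-- Local martingales with càdlàg paths. -/
def IsLocMart (P : Measure Ω) (ℱ : Filtration (Iic T) mΩ) (M : Iic T → Ω → ℝ) : Prop :=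
  Locally (fun N => Martingale N ℱ P ∧ ∀ᵐ ω ∂P, IsCadlagPath (fun t => N t ω)) ℱ M P

/-- Real semimartingales: adapted càdlàg processes that are the sum of a local martingale and an
adapted càdlàg process of finite variation. -/
def IsSemimart (P : Measure Ω) (ℱ : Filtration (Iic T) mΩ) (S : Iic T → Ω → ℝ) : Prop :=
  StronglyAdapted ℱ S ∧ (∀ᵐ ω ∂P, IsCadlagPath (fun t => S t ω)) ∧
    ∃ M A : Iic T → Ω → ℝ, IsLocMart P ℱ M ∧ StronglyAdapted ℱ A ∧
      (∀ᵐ ω ∂P, IsCadlagPath (fun t => A t ω) ∧ BoundedVariationOn (fun t => A t ω) univ) ∧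
      ∀ᵐ ω ∂P, ∀ t, S t ω = M t ω + A t ω

/-- Uniform convergence in probability on `[0, T]`. -/
def TendstoUCP (P : Measure Ω) (Xn : ℕ → Iic T → Ω → ℝ) (X : Iic T → Ω → ℝ) : Prop :=
  ∀ ε : ℝ, 0 < ε → Tendsto (fun n => P {ω | ∃ r, ε ≤ |Xn n r ω - X r ω|}) atTop (𝓝 0)

/-- The integral over `(0, r]` of the simple process `∑ k < m, κ k 1_{(t k, t (k+1)]}` with respect
to a real process `D`. -/
def simpleIntegral (m : ℕ) (t : ℕ → Iic T) (κ : ℕ → Ω → ℝ) (D : Iic T → Ω → ℝ) :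
    Iic T → Ω → ℝ :=
  fun r ω => ∑ k ∈ Finset.range m, κ k ω * (D (min r (t (k + 1))) ω - D (min r (t k)) ω)

/-- Convergence in Émery's semimartingale topology on `[0, T]`: the initial values converge in
probability and the integrals of simple predictable processes bounded by one converge to zero
uniformly on `[0, T]` in probability, uniformly over such integrands. -/
def TendstoEmery (P : Measure Ω) (ℱ : Filtration (Iic T) mΩ) (Xn : ℕ → Iic T → Ω → ℝ)
    (X : Iic T → Ω → ℝ) : Prop :=
  ∀ ε : ℝ, 0 < ε → ∃ N : ℕ, ∀ n ≥ N, ∀ (m : ℕ) (t : ℕ → Iic T) (κ : ℕ → Ω → ℝ),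
    Monotone t → (∀ k, Measurable[ℱ (t k)] (κ k)) → (∀ k ω, |κ k ω| ≤ 1) →
      P {ω | ∃ r, ε ≤ |Xn n ⊥ ω - X ⊥ ω| + |simpleIntegral m t κ (Xn n - X) r ω|}
        ≤ ENNReal.ofReal ε

/-- `IsBddIntegral P ℱ S H X`: the process `X` is (a version of) the stochastic integral over
`(0, r]` of the bounded predictable `ℝ^d`-valued process `H` with respect to the `ℝ^d`-valued
process `S`. It is given by the elementary formula on simple predictable processes and extended by
linearity and by dominated convergence: uniformly bounded pointwise convergence of the integrands
goes along with uniform convergence in probability of the integrals. -/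
inductive IsBddIntegral {d : ℕ} (P : Measure Ω) (ℱ : Filtration (Iic T) mΩ)
    (S : Iic T → Ω → Fin d → ℝ) : (Iic T → Ω → Fin d → ℝ) → (Iic T → Ω → ℝ) → Prop
  | zero_time (ξ : Ω → Fin d → ℝ) (hξ : Measurable[ℱ ⊥] ξ) (c : ℝ) (hc : ∀ ω i, |ξ ω i| ≤ c) :
      IsBddIntegral P ℱ S (fun r ω => if r = ⊥ then ξ ω else 0) (fun _ _ => 0)
  | simple (s t : Iic T) (hst : s ≤ t) (ξ : Ω → Fin d → ℝ) (hξ : Measurable[ℱ s] ξ) (c : ℝ)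
      (hc : ∀ ω i, |ξ ω i| ≤ c) :
      IsBddIntegral P ℱ S (fun r ω => if s < r ∧ r ≤ t then ξ ω else 0)
        (fun r ω => ∑ i, ξ ω i * (S (min r t) ω i - S (min r s) ω i))
  | add (H H' : Iic T → Ω → Fin d → ℝ) (X X' : Iic T → Ω → ℝ) (h : IsBddIntegral P ℱ S H X)
      (h' : IsBddIntegral P ℱ S H' X') : IsBddIntegral P ℱ S (H + H') (X + X')
  | lim (Hn : ℕ → Iic T → Ω → Fin d → ℝ) (Xn : ℕ → Iic T → Ω → ℝ) (H : Iic T → Ω → Fin d → ℝ)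
      (X : Iic T → Ω → ℝ) (hn : ∀ n, IsBddIntegral P ℱ S (Hn n) (Xn n)) (c : ℝ)
      (hc : ∀ n r ω i, |Hn n r ω i| ≤ c)
      (hH : ∀ r ω i, Tendsto (fun n => Hn n r ω i) atTop (𝓝 (H r ω i)))
      (hX : TendstoUCP P Xn X) : IsBddIntegral P ℱ S H X

open Classical in
/-- The truncation `H 1_{|H| ≤ n}`. -/
def truncProc {d : ℕ} (H : Iic T → Ω → Fin d → ℝ) (n : ℕ) : Iic T → Ω → Fin d → ℝ :=
  fun r ω => if ∀ i, |H r ω i| ≤ n then H r ω else 0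

/-- `IsStochIntegral P ℱ S H X`: the process `H` belongs to `L(S)`, that is, it is predictable and
`S`-integrable (as a vector), and `X` is (a version of) the integral process `H · S`. Integrability
means that the integrals of the truncations `H 1_{|H| ≤ n}` converge in the semimartingale topology,
and the limit is the integral. -/
def IsStochIntegral {d : ℕ} (P : Measure Ω) (ℱ : Filtration (Iic T) mΩ)
    (S : Iic T → Ω → Fin d → ℝ) (H : Iic T → Ω → Fin d → ℝ) (X : Iic T → Ω → ℝ) : Prop :=
  IsStronglyPredictable ℱ H ∧ ∃ Xn : ℕ → Iic T → Ω → ℝ,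
    (∀ n, IsBddIntegral P ℱ S (truncProc H n) (Xn n)) ∧ TendstoEmery P ℱ Xn X

/-- A wealth process is tame if its infimum over `[0, T]` belongs to the Orlicz space. -/
def IsTameWealth (P : Measure Ω) (U : ℝ → EReal) (X : Iic T → Ω → ℝ) : Prop :=
  ∃ I : Ω → ℝ, MemOrlicz (youngU U) P I ∧ ∀ᵐ ω ∂P, IsGLB (range fun t => X t ω) (I ω)

/-- The cone `K` of terminal wealths of tame strategies with zero initial capital. -/
def tameTerminal {d : ℕ} (P : Measure Ω) (ℱ : Filtration (Iic T) mΩ) (S : Iic T → Ω → Fin d → ℝ)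
    (U : ℝ → EReal) : Set (Ω → ℝ) :=
  {k | ∃ H X, IsStochIntegral P ℱ S H X ∧ IsTameWealth P U X ∧ k = X ⊤}

/-- The cone `C = (K - L⁰₊) ∩ L^Û` of claims that are super-replicable with zero initial capital. -/
def superReplicable {d : ℕ} (P : Measure Ω) (ℱ : Filtration (Iic T) mΩ)
    (S : Iic T → Ω → Fin d → ℝ) (U : ℝ → EReal) : Set (Ω → ℝ) :=
  {X | MemOrlicz (youngU U) P X ∧ ∃ k ∈ tameTerminal P ℱ S U, ∃ l : Ω → ℝ,
    AEMeasurable l P ∧ 0 ≤ᵐ[P] l ∧ X =ᵐ[P] k - l}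

end Market

end

/-!
The Orlicz space `L` of the Young function `youngU U` is the dual of the Orlicz heart `M` of the
conjugate `youngV U`, because the superlinear left tail of `U` makes `youngV U` finite. For a
perturbation `Z ∈ M` consider the value of the dual problem,
`v Z = inf {I_V (Y + Z) + E[(Y + Z) B] | Y ∈ C*}`. This is a convex function on `M`, and its
conjugate at `-X` is `-I_U (B + X)` if `X ∈ C**` and `+∞` otherwise. Hence the lower semicontinuous
hull of `v` at the origin is `sup {I_U (B + X) | X ∈ C**}`, which is the maximal utility over `C` by
assumption, and nearly optimal `Y` for perturbations `Z` of small norm give the two sequences. This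
is a statement about arbitrary subsets `C` of `L` (`exists_dual_sequence`).

The argument rests on the following facts.
* Weak duality (`intFun_le_dual_add_pairing`): `I_U (B + X) ≤ I_V (Y + Z) + E[(Y + Z) B] + E[X Z]`.
  As `E[X Z]` is bounded by a multiple of the norm of `Z` (`exists_pairing_bound`), this controls
  the lower limit of the dual values.
* If `v ≥ r` on a ball, then weak duality with a feasible claim `X₀` gives `v ≥ r - K * ‖·‖` on all
  of `M`, so that the Hahn–Banach theorem yields a bounded affine minorant with value `r` at the
  origin (`Seminorm.exists_affine_minorant`); no vertical separation can occur.
* Bounded functionals on `M` are of the form `Z ↦ E[X Z]` with `X ∈ L`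
  (`exists_memOrlicz_of_bounded`), by the Radon–Nikodym theorem.
* Interchange of infimum and expectation (`le_intFun_of_forall_majorant`): `U` is the lower envelope
  of countably many affine functions, so `U (ξ)` is the decreasing limit of minima of finitely many
  affine functions of `ξ`, with bounded measurable selections of their slopes and intercepts. It
  serves both to put the Radon–Nikodym density into `L` and to turn the affine minorant into the
  bound `r ≤ I_U (B + X)` for some `X ∈ C**` (`exists_bipolar_le_intFun`).
-/

/-! ### Affine majorants of a utility function -/

section Majorants

variable {U : ℝ → EReal}

theorem IsUtility.isClosed_hypograph (hU : IsUtility U) :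
    IsClosed {p : ℝ × ℝ | (p.2 : EReal) ≤ U p.1} := by
  have h := (upperSemicontinuous_iff_IsClosed_hypograph (f := U)).1 hU.usc
  exact h.preimage (continuous_fst.prodMk (continuous_coe_real_ereal.comp continuous_snd))

/-- Comparison with a real number, tested on the real points of the hypograph. -/
theorem IsUtility.le_coe_of_forall (hU : IsUtility U) {x g : ℝ}
    (h : ∀ u : ℝ, (u : EReal) ≤ U x → u ≤ g) : U x ≤ g := by
  have := hU.lt_top x
  generalize U x = e at *
  induction e with
  | bot => exact bot_le
  | coe u => exact EReal.coe_le_coe_iff.2 (h u le_rfl)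
  | top => exact absurd this (lt_irrefl _)

/-- Fenchel–Moreau: a point above the graph of `U` lies above an affine majorant of `U`. -/
theorem IsNormalizedUtility.exists_affine_lt (hU : IsNormalizedUtility U) {x t : ℝ}
    (hx : U x < t) : ∃ y c : ℝ, (∀ z : ℝ, U z ≤ (c + y * z : ℝ)) ∧ c + y * x < t := by
  -- a strictly separating functional that is not vertical gives an affine majorant
  have key : ∀ {a b s : ℝ}, (∀ z u : ℝ, (u : EReal) ≤ U z → a * z + b * u < s) → 0 < b →
      ∀ z : ℝ, U z ≤ (s / b + (-a / b) * z : ℝ) := by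
    intro a b s h hb z
    refine hU.le_coe_of_forall fun u hu => ?_
    have h1 := h z u hu
    have h2 : s / b + -a / b * z = (s - a * z) / b := by ring
    rw [h2, le_div_iff₀ hb]
    linarith
  have sep : ∀ {x t : ℝ}, U x < t → ∃ a b s : ℝ,
      (∀ z u : ℝ, (u : EReal) ≤ U z → a * z + b * u < s) ∧ s < a * x + b * t := by
    intro x t hx
    obtain ⟨f, s, hf, hs⟩ := geometric_hahn_banach_closed_point (x := ((x, t) : ℝ × ℝ))
      hU.concave hU.isClosed_hypograph (by simpa using hx)
    have hfe : ∀ p q : ℝ, f (p, q) = f (1, 0) * p + f (0, 1) * q := by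
      intro p q
      have : ((p, q) : ℝ × ℝ) = p • (1, 0) + q • (0, 1) := by simp
      rw [this, map_add, map_smul, map_smul]
      simp [mul_comm]
    refine ⟨f (1, 0), f (0, 1), s, fun z u h => ?_, ?_⟩
    · rw [← hfe]; exact hf _ h
    · rw [← hfe]; exact hs
  have h00 : ((0 : ℝ) : EReal) ≤ U 0 := by simp [hU.map_zero]
  obtain ⟨a, b, s, h, hs⟩ := sep hx
  have hb : 0 ≤ b := by
    by_contra! hb
    have h1 := h 0 (-(|s| / -b)) (le_trans (by
      have : 0 ≤ |s| / -b := div_nonneg (abs_nonneg _) (by linarith)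
      exact_mod_cast (by linarith : -(|s| / -b) ≤ 0)) h00)
    have h2 : b * -(|s| / -b) = |s| := by
      have := hb.ne
      field_simp
    have := le_abs_self s
    linarith
  rcases hb.lt_or_eq with hb | rfl
  · refine ⟨-a / b, s / b, key h hb, ?_⟩
    have h2 : s / b + -a / b * x = (s - a * x) / b := by ring
    rw [h2, div_lt_iff₀ hb]
    linarith
  · -- a vertical separation is tilted by an affine majorant, obtained at the interior point `0`
    obtain ⟨a', b', s', h', hs'⟩ := sep (x := 0) (t := 1) (by rw [hU.map_zero]; simp)
    have hb' : 0 < b' := by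
      have := h' 0 0 h00
      linarith
    set δ := a * x - s with hδ
    have hδ0 : 0 < δ := by linarith
    set g := s' / b' + (-a' / b') * x with hg
    set k := (|g - t| + 1) / δ with hk
    have hk0 : 0 ≤ k := by positivity
    refine ⟨-a' / b' - k * a, s' / b' + k * s, fun z => ?_, ?_⟩
    · refine hU.le_coe_of_forall fun u hu => ?_
      have h1 := hu.trans (key h' hb' z)
      have h1 := EReal.coe_le_coe_iff.1 h1
      have h2 := h z u hu
      nlinarith [mul_nonneg hk0 (by linarith : 0 ≤ s - a * z)]
    · have h1 : k * δ = |g - t| + 1 := by rw [hk]; field_simp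
      have h2 := le_abs_self (g - t)
      have : s' / b' + k * s + (-a' / b' - k * a) * x = g - k * δ := by rw [hg, hδ]; ring
      rw [this, h1]; linarith

/-- A utility function is the lower envelope of countably many affine majorants. -/
theorem IsNormalizedUtility.exists_affine_seq (hU : IsNormalizedUtility U) :
    ∃ y c : ℕ → ℝ, (∀ k z, U z ≤ (c k + y k * z : ℝ)) ∧
      ∀ x t : ℝ, U x < t → ∃ k, c k + y k * x < t := by
  set I : Type := {q : ℝ × ℝ // ∀ z : ℝ, U z ≤ (q.2 + q.1 * z : ℝ)}
  obtain ⟨T, hT, hTU⟩ := TopologicalSpace.isOpen_iUnion_countable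
    (fun q : I => {p : ℝ × ℝ | q.1.2 + q.1.1 * p.1 < p.2})
    (fun q => isOpen_lt (by fun_prop) (by fun_prop))
  have cov : ∀ x t : ℝ, U x < t → ∃ q ∈ T, q.1.2 + q.1.1 * x < t := by
    intro x t hxt
    obtain ⟨y, c, h1, h2⟩ := hU.exists_affine_lt hxt
    have : ((x, t) : ℝ × ℝ) ∈ ⋃ q : I, {p : ℝ × ℝ | q.1.2 + q.1.1 * p.1 < p.2} :=
      mem_iUnion.2 ⟨⟨(y, c), h1⟩, h2⟩
    rw [← hTU] at this
    simpa using this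
  have hne : T.Nonempty := by
    obtain ⟨q, hq, -⟩ := cov 0 1 (by rw [hU.map_zero]; simp)
    exact ⟨q, hq⟩
  obtain ⟨e, rfl⟩ := hT.exists_eq_range hne
  refine ⟨fun k => (e k).1.1, fun k => (e k).1.2, fun k => (e k).2, fun x t h => ?_⟩
  obtain ⟨_, ⟨k, rfl⟩, hk⟩ := cov x t h
  exact ⟨k, hk⟩

theorem IsNormalizedUtility.nonneg_of_nonneg (hU : IsNormalizedUtility U) {x : ℝ} (hx : 0 ≤ x) :
    0 ≤ U x := hU.map_zero ▸ hU.mono hx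

theorem IsNormalizedUtility.nonpos_of_nonpos (hU : IsNormalizedUtility U) {x : ℝ} (hx : x ≤ 0) :
    U x ≤ 0 := hU.map_zero ▸ hU.mono hx

theorem IsNormalizedUtility.slope_nonneg (hU : IsNormalizedUtility U) {y c : ℝ}
    (h : ∀ z : ℝ, U z ≤ (c + y * z : ℝ)) : 0 ≤ y := by
  by_contra! hy
  have hz : 0 ≤ (|c| + 1) / -y := div_nonneg (by positivity) (by linarith)
  have h1 := (hU.nonneg_of_nonneg hz).trans (h _)
  have h1 : 0 ≤ c + y * ((|c| + 1) / -y) := by exact_mod_cast h1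
  have h2 : y * ((|c| + 1) / -y) = -(|c| + 1) := by
    have := hy.ne
    field_simp
  linarith [le_abs_self c]

theorem IsNormalizedUtility.intercept_nonneg (hU : IsNormalizedUtility U) {y c : ℝ}
    (h : ∀ z : ℝ, U z ≤ (c + y * z : ℝ)) : 0 ≤ c := by
  have h1 := h 0
  rw [hU.map_zero] at h1
  simpa using h1

end Majorants

/-! ### The Young function and its conjugate -/

section Young

variable {U : ℝ → EReal}

theorem youngU_neg (U : ℝ → EReal) (x : ℝ) : youngU U (-x) = youngU U x := by
  simp [youngU]

/-- Young's inequality together with the minimality of the conjugate, in `[0, ∞]`. -/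
theorem youngV_le_iff (U : ℝ → EReal) (y : ℝ) (t : ℝ≥0∞) :
    youngV U y ≤ t ↔ ∀ x : ℝ, ENNReal.ofReal (x * y) ≤ youngU U x + t := by
  have h1 : youngV U y ≤ t ↔
      (⨆ x : ℝ, ((x * y : ℝ) : EReal) - (youngU U x : EReal)) ≤ (t : EReal) := by
    rw [youngV, youngConj]
    constructor
    · intro h
      rw [← EReal.coe_ennreal_le_coe_ennreal_iff, EReal.coe_toENNReal_eq_max] at h
      exact (le_max_right _ _).trans h
    · intro h
      simpa using EReal.toENNReal_le_toENNReal h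
  rw [h1, iSup_le_iff]
  refine forall_congr' fun x => ?_
  rw [EReal.sub_le_iff_le_add (Or.inl (by simp)) (Or.inr (by simp)), add_comm,
    ← EReal.coe_ennreal_add]
  constructor
  · intro h
    have := EReal.toENNReal_le_toENNReal h
    rwa [EReal.toENNReal_coe, EReal.real_coe_toENNReal] at this
  · intro h
    rw [← EReal.coe_ennreal_le_coe_ennreal_iff, EReal.coe_ennreal_ofReal] at h
    exact le_trans (by exact_mod_cast le_max_left _ _) h

theorem ofReal_mul_le_youngU_add_youngV (U : ℝ → EReal) (x y : ℝ) :
    ENNReal.ofReal (x * y) ≤ youngU U x + youngV U y :=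
  (youngV_le_iff U y _).1 le_rfl x

theorem ofReal_abs_mul_le_youngU_add_youngV (U : ℝ → EReal) (x y : ℝ) :
    ENNReal.ofReal |x * y| ≤ youngU U x + youngV U y := by
  rcases abs_choice (x * y) with h | h <;> rw [h]
  · exact ofReal_mul_le_youngU_add_youngV U x y
  · have := ofReal_mul_le_youngU_add_youngV U (-x) y
    rwa [youngU_neg, neg_mul] at this

theorem youngV_zero (U : ℝ → EReal) : youngV U 0 = 0 := by
  rw [← nonpos_iff_eq_zero, youngV_le_iff]
  simp

theorem youngV_mono_abs (U : ℝ → EReal) {y z : ℝ} (h : |y| ≤ |z|) : youngV U y ≤ youngV U z := by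
  rw [youngV_le_iff]
  intro x
  refine (ENNReal.ofReal_le_ofReal ?_).trans (ofReal_abs_mul_le_youngU_add_youngV U x z)
  rw [abs_mul]
  exact (le_abs_self _).trans (by rw [abs_mul]; gcongr)

theorem youngV_convex (U : ℝ → EReal) {a b : ℝ} (ha : 0 ≤ a) (hb : 0 ≤ b) (hab : a + b = 1)
    (y z : ℝ) : youngV U (a * y + b * z) ≤
      ENNReal.ofReal a * youngV U y + ENNReal.ofReal b * youngV U z := by
  rw [youngV_le_iff]
  intro x
  have h1 : x * (a * y + b * z) = a * (x * y) + b * (x * z) := by ring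
  have h2 : youngU U x = ENNReal.ofReal a * youngU U x + ENNReal.ofReal b * youngU U x := by
    rw [← add_mul, ← ENNReal.ofReal_add ha hb, hab]; simp
  calc ENNReal.ofReal (x * (a * y + b * z))
      ≤ ENNReal.ofReal a * ENNReal.ofReal (x * y) + ENNReal.ofReal b * ENNReal.ofReal (x * z) := by
        rw [h1, ← ENNReal.ofReal_mul ha, ← ENNReal.ofReal_mul hb]
        exact ENNReal.ofReal_add_le
    _ ≤ ENNReal.ofReal a * (youngU U x + youngV U y)
        + ENNReal.ofReal b * (youngU U x + youngV U z) := by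
        gcongr <;> exact ofReal_mul_le_youngU_add_youngV U _ _
    _ = youngU U x + (ENNReal.ofReal a * youngV U y + ENNReal.ofReal b * youngV U z) := by
        conv_rhs => rw [h2]
        ring

theorem youngV_smul_le (U : ℝ → EReal) {a : ℝ} (ha : 0 ≤ a) (ha1 : a ≤ 1) (y : ℝ) :
    youngV U (a * y) ≤ ENNReal.ofReal a * youngV U y := by
  simpa [youngV_zero] using youngV_convex U ha (sub_nonneg.2 ha1) (by ring) y 0

/-- The superlinear left tail of `U` makes the conjugate Young function finite. -/
theorem youngV_lt_top (hSL : IsSuperlinear U) (y : ℝ) : youngV U y < ⊤ := by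
  obtain ⟨R, hR⟩ := eventually_atBot.1 (hSL.eventually (lt_mem_nhds (EReal.coe_lt_top |y|)))
  have hle : youngV U y ≤ ENNReal.ofReal ((|R| + 1) * |y|) := by
    rw [youngV_le_iff]
    intro x
    rcases le_or_gt |x| (|R| + 1) with hx | hx
    · refine le_add_left (ENNReal.ofReal_le_ofReal ?_)
      refine (le_abs_self _).trans ?_
      rw [abs_mul]; gcongr
    · refine le_add_right ?_
      have hx0 : 0 < |x| := by have := abs_nonneg R; linarith
      have h1 : ((|y| : ℝ) : EReal) < U (-|x|) / ((-|x| : ℝ) : EReal) := by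
        simpa using hR (-|x|) (by have := neg_abs_le R; linarith)
      have h2 : U (-|x|) ≤ ((-(|x| * |y|) : ℝ) : EReal) := by
        generalize U (-|x|) = e at *
        induction e with
        | bot => exact bot_le
        | coe u =>
          rw [← EReal.coe_div, EReal.coe_lt_coe_iff, lt_div_iff_of_neg (by linarith)] at h1
          rw [EReal.coe_le_coe_iff]
          nlinarith
        | top =>
          rw [EReal.top_div_of_neg_ne_bot (by exact_mod_cast (by linarith)) (by simp)] at h1
          exact absurd h1 (by simp)
      rw [youngU]
      have h3 : ((x * y : ℝ) : EReal) ≤ -U (-|x|) := by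
        rw [EReal.le_neg]
        refine h2.trans ?_
        rw [← EReal.coe_neg, EReal.coe_le_coe_iff]
        have := le_abs_self (x * y)
        rw [abs_mul] at this
        linarith
      rw [← EReal.real_coe_toENNReal]
      exact EReal.toENNReal_le_toENNReal h3
  exact hle.trans_lt ENNReal.ofReal_lt_top

/-- The intercept of an affine majorant of `U` dominates the conjugate Young function at its
slope. -/
theorem youngV_le_intercept (hU : IsNormalizedUtility U) {y c : ℝ}
    (h : ∀ z : ℝ, U z ≤ (c + y * z : ℝ)) : youngV U y ≤ ENNReal.ofReal c := by
  have hc := hU.intercept_nonneg h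
  have hy := hU.slope_nonneg h
  rw [youngV_le_iff]
  intro x
  have h1 := EReal.neg_le_neg_iff.2 (h (-|x|))
  rw [← EReal.coe_neg] at h1
  have h2 := EReal.toENNReal_le_toENNReal h1
  rw [EReal.real_coe_toENNReal] at h2
  refine le_trans ?_ (add_le_add_left h2 _)
  rw [add_comm]
  refine le_trans (ENNReal.ofReal_le_ofReal ?_) ENNReal.ofReal_add_le
  nlinarith [le_abs_self x]

theorem measurable_utility (hU : IsUtility U) : Measurable U := hU.usc.measurable

theorem measurable_youngU (hU : IsUtility U) : Measurable (youngU U) := by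
  have : Measurable fun x : ℝ => U (-|x|) := (measurable_utility hU).comp (by fun_prop)
  exact this.neg.ereal_toENNReal

theorem measurable_youngV (U : ℝ → EReal) : Measurable (youngV U) := by
  have h : youngV U = fun y => youngV U |y| := by
    funext y
    exact le_antisymm (youngV_mono_abs U (by simp)) (youngV_mono_abs U (by simp))
  have hm : Monotone fun y => youngV U (max y 0) := by
    intro a b hab
    refine youngV_mono_abs U ?_
    rw [abs_of_nonneg (le_max_right _ _), abs_of_nonneg (le_max_right _ _)]
    exact max_le_max_right _ hab
  have : youngV U = (fun y => youngV U (max y 0)) ∘ fun y : ℝ => |y| := by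
    funext y
    rw [h]
    simp
  rw [this]
  exact hm.measurable.comp (by fun_prop)

end Young

/-! ### Expectations of extended-real functions -/

section Expectation

variable {Ω : Type*} {mΩ : MeasurableSpace Ω} {P : Measure Ω} {U : ℝ → EReal}

theorem eExp_mono_ae {ξ η : Ω → EReal} (h : ∀ᵐ ω ∂P, ξ ω ≤ η ω) : eExp P ξ ≤ eExp P η := by
  refine EReal.sub_le_sub ?_ ?_
  · exact_mod_cast lintegral_mono_ae (h.mono fun ω hω => EReal.toENNReal_le_toENNReal hω)
  · exact_mod_cast lintegral_mono_ae
      (h.mono fun ω hω => EReal.toENNReal_le_toENNReal (EReal.neg_le_neg_iff.2 hω))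

theorem eExp_congr_ae {ξ η : Ω → EReal} (h : ∀ᵐ ω ∂P, ξ ω = η ω) : eExp P ξ = eExp P η :=
  le_antisymm (eExp_mono_ae (h.mono fun _ hω => hω.le)) (eExp_mono_ae (h.mono fun _ hω => hω.ge))

theorem eExp_coe {h : Ω → ℝ} (hh : Integrable h P) :
    eExp P (fun ω => (h ω : EReal)) = ((∫ ω, h ω ∂P : ℝ) : EReal) := by
  have h1 : ∫⁻ ω, ENNReal.ofReal (h ω) ∂P ≠ ⊤ :=
    (hh.lintegral_lt_top).ne
  have h2 : ∫⁻ ω, ENNReal.ofReal (-h ω) ∂P ≠ ⊤ :=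
    (hh.neg.lintegral_lt_top).ne
  rw [integral_eq_lintegral_pos_part_sub_lintegral_neg_part hh, eExp, EReal.coe_sub]
  congr 1
  · simp only [EReal.real_coe_toENNReal]
    exact (EReal.coe_ennreal_toReal h1).symm
  · simp only [← EReal.coe_neg, EReal.real_coe_toENNReal]
    exact (EReal.coe_ennreal_toReal h2).symm

/-- Monotone convergence from above: integrals of real functions decreasing to an extended-real
function bound its expectation from below. -/
theorem le_eExp_of_antitone {g : ℕ → Ω → ℝ} {G : Ω → EReal} {r : ℝ}
    (hg : ∀ n, Integrable (g n) P) (hanti : ∀ ω, Antitone fun n => g n ω)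
    (hr : ∀ n, r ≤ ∫ ω, g n ω ∂P) (hG : AEMeasurable G P)
    (hle : ∀ᵐ ω ∂P, ∀ n, G ω ≤ (g n ω : EReal))
    (hlim : ∀ᵐ ω ∂P, ∀ t : ℝ, G ω < t → ∃ n, g n ω < t) : (r : EReal) ≤ eExp P G := by
  -- integrability of `G` and the bound come from monotone convergence of `g 0 - g n`
  set φ : Ω → ℝ≥0∞ := fun ω => ⨆ n, ENNReal.ofReal (g 0 ω - g n ω) with hφ
  have hφint : ∫⁻ ω, φ ω ∂P ≤ ENNReal.ofReal (∫ ω, g 0 ω ∂P - r) := by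
    have hm : ∀ n, AEMeasurable (fun ω => ENNReal.ofReal (g 0 ω - g n ω)) P :=
      fun n => ((hg 0).sub (hg n)).aemeasurable.ennreal_ofReal
    rw [lintegral_iSup' hm (ae_of_all _ fun ω i j hij => ENNReal.ofReal_le_ofReal
      (sub_le_sub_left (hanti ω hij) _))]
    refine iSup_le fun n => ?_
    have := ofReal_integral_eq_lintegral_ofReal ((hg 0).sub (hg n))
      (ae_of_all _ fun ω => by
        have : g n ω ≤ g 0 ω := hanti ω (Nat.zero_le n)
        simpa using this)
    simp only [Pi.sub_apply] at this
    rw [← this, integral_sub (hg 0) (hg n)]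
    exact ENNReal.ofReal_le_ofReal (by linarith [hr n])
  have hφm : AEMeasurable φ P :=
    AEMeasurable.iSup fun n => ((hg 0).sub (hg n)).aemeasurable.ennreal_ofReal
  have hφfin : ∀ᵐ ω ∂P, φ ω < ⊤ :=
    ae_lt_top' hφm (hφint.trans_lt ENNReal.ofReal_lt_top).ne
  have hφi : Integrable (fun ω => (φ ω).toReal) P :=
    integrable_toReal_of_lintegral_ne_top hφm (hφint.trans_lt ENNReal.ofReal_lt_top).ne
  have hφr : ∫ ω, (φ ω).toReal ∂P ≤ ∫ ω, g 0 ω ∂P - r := by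
    rw [integral_toReal hφm hφfin]
    exact ENNReal.toReal_le_of_le_ofReal (by linarith [hr 0]) hφint
  have key : ∀ᵐ ω ∂P, G ω = ((G ω).toReal : EReal) ∧ (G ω).toReal ≤ g 0 ω ∧
      g 0 ω - (φ ω).toReal ≤ (G ω).toReal := by
    filter_upwards [hφfin, hle, hlim] with ω h1 h2 h3
    have h4 : ∀ n, g 0 ω - (φ ω).toReal ≤ g n ω := by
      intro n
      have : ENNReal.ofReal (g 0 ω - g n ω) ≤ φ ω := le_iSup (fun n => ENNReal.ofReal _) n
      have := ENNReal.toReal_mono h1.ne this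
      have h5 := le_max_left (g 0 ω - g n ω) 0
      rw [ENNReal.toReal_ofReal'] at this
      linarith
    have h5 : ((g 0 ω - (φ ω).toReal : ℝ) : EReal) ≤ G ω := by
      by_contra! hlt
      obtain ⟨n, hn⟩ := h3 _ hlt
      linarith [h4 n]
    have h0 := h2 0
    generalize G ω = e at *
    induction e with
    | bot => exact absurd h5 (not_le.2 (EReal.bot_lt_coe _))
    | coe u => exact ⟨rfl, EReal.coe_le_coe_iff.1 h0, EReal.coe_le_coe_iff.1 h5⟩
    | top => simp at h0
  have hGi : Integrable (fun ω => (G ω).toReal) P := by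
    refine Integrable.mono' ((hg 0).norm.add hφi) hG.ereal_toReal.aestronglyMeasurable ?_
    filter_upwards [key] with ω ⟨_, h1, h2⟩
    have := abs_le.1 (le_refl |g 0 ω|)
    have h3 : 0 ≤ (φ ω).toReal := ENNReal.toReal_nonneg
    simp only [Pi.add_apply, Real.norm_eq_abs]
    exact abs_le.2 ⟨by linarith, by linarith⟩
  rw [eExp_congr_ae (key.mono fun ω h => h.1), eExp_coe hGi, EReal.coe_le_coe_iff]
  have h1 : ∫ ω, (g 0 ω - (φ ω).toReal) ∂P ≤ ∫ ω, (G ω).toReal ∂P :=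
    integral_mono_ae ((hg 0).sub hφi) hGi (key.mono fun ω h => h.2.2)
  rw [integral_sub (hg 0) hφi] at h1
  linarith

/-- Running minimizers of finitely many affine functions, evaluated along a measurable function. -/
theorem exists_measurable_argmin (y c : ℕ → ℝ) {ξ : Ω → ℝ} (hξ : Measurable ξ) :
    ∃ W D : ℕ → Ω → ℝ, (∀ n, Measurable (W n)) ∧ (∀ n, Measurable (D n)) ∧
      (∀ n, ∃ M : ℝ, ∀ ω, |W n ω| ≤ M ∧ |D n ω| ≤ M) ∧
      (∀ n ω, ∃ k, W n ω = y k ∧ D n ω = c k) ∧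
      (∀ ω, Antitone fun n => D n ω + W n ω * ξ ω) ∧
      ∀ n ω, D n ω + W n ω * ξ ω ≤ c n + y n * ξ ω := by
  classical
  obtain ⟨F, hF0, hF⟩ : ∃ F : ℕ → Ω → ℝ × ℝ, (∀ ω, F 0 ω = (y 0, c 0)) ∧ ∀ n ω, F (n + 1) ω =
      if c (n + 1) + y (n + 1) * ξ ω < (F n ω).2 + (F n ω).1 * ξ ω
      then (y (n + 1), c (n + 1)) else F n ω :=
    ⟨fun n => Nat.rec (fun _ => (y 0, c 0))
      (fun n f ω => if c (n + 1) + y (n + 1) * ξ ω < (f ω).2 + (f ω).1 * ξ ω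
        then (y (n + 1), c (n + 1)) else f ω) n, fun _ => rfl, fun _ _ => rfl⟩
  have hm : ∀ n, Measurable (F n) := by
    intro n
    induction n with
    | zero =>
      rw [funext hF0]
      exact measurable_const
    | succ n ih =>
      rw [funext (hF n)]
      exact Measurable.ite (measurableSet_lt (by fun_prop) (by fun_prop)) measurable_const ih
  refine ⟨fun n ω => (F n ω).1, fun n ω => (F n ω).2, fun n => (hm n).fst, fun n => (hm n).snd,
    ?_, ?_, ?_, ?_⟩
  · intro n
    induction n with
    | zero => 
      refine ⟨max |y 0| |c 0|, fun ω => ?_⟩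
      simp only [hF0]
      exact ⟨le_max_left _ _, le_max_right _ _⟩
    | succ n ih =>
      obtain ⟨M, hM⟩ := ih
      refine ⟨max M (max |y (n + 1)| |c (n + 1)|), fun ω => ?_⟩
      simp only [hF]
      split_ifs
      · exact ⟨(le_max_left _ _).trans (le_max_right _ _),
          (le_max_right _ _).trans (le_max_right _ _)⟩
      · exact ⟨(hM ω).1.trans (le_max_left _ _), (hM ω).2.trans (le_max_left _ _)⟩
  · intro n ω
    induction n with
    | zero => exact ⟨0, by simp only [hF0], by simp only [hF0]⟩
    | succ n ih =>
      simp only [hF]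
      split_ifs
      · exact ⟨n + 1, rfl, rfl⟩
      · exact ih
  · intro ω
    refine antitone_nat_of_succ_le fun n => ?_
    simp only [hF]
    split_ifs with h
    · exact h.le
    · exact le_rfl
  · intro n ω
    cases n with
    | zero => simp only [hF0, le_refl]
    | succ n =>
      simp only [hF]
      split_ifs with h
      · exact le_rfl
      · exact not_lt.1 h

/-- Interchange of infimum and expectation: expected utility is bounded below by `r` as soon as all
measurable selections of affine majorants with bounded coefficients have expectation at least
`r`. -/
theorem le_intFun_of_forall_majorant [IsFiniteMeasure P] (hU : IsNormalizedUtility U) {ξ : Ω → ℝ}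
    (hξ : Integrable ξ P) {r : ℝ}
    (h : ∀ W D : Ω → ℝ, Measurable W → Measurable D →
      (∃ M : ℝ, ∀ ω, |W ω| ≤ M ∧ |D ω| ≤ M) → (∀ ω z, U z ≤ (D ω + W ω * z : ℝ)) →
      r ≤ ∫ ω, (D ω + W ω * ξ ω) ∂P) : (r : EReal) ≤ intFun P U ξ := by
  obtain ⟨y, c, hmaj, henv⟩ := hU.exists_affine_seq
  obtain ⟨ξ', hξ', hae⟩ := hξ.aemeasurable
  have hξi : Integrable ξ' P := hξ.congr hae
  obtain ⟨W, D, hW, hD, hbd, hval, hanti, hmin⟩ := exists_measurable_argmin y c hξ'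
  have hmajW : ∀ n ω z, U z ≤ (D n ω + W n ω * z : ℝ) := by
    intro n ω z
    obtain ⟨k, h1, h2⟩ := hval n ω
    rw [h1, h2]; exact hmaj k z
  have hgi : ∀ n, Integrable (fun ω => D n ω + W n ω * ξ' ω) P := by
    intro n
    obtain ⟨M, hM⟩ := hbd n
    refine Integrable.add ?_ ?_
    · exact Integrable.of_bound (hD n).aestronglyMeasurable M (ae_of_all _ fun ω => (hM ω).2)
    · exact hξi.bdd_mul (hW n).aestronglyMeasurable (ae_of_all _ fun ω => (hM ω).1)
  have e : intFun P U ξ = eExp P fun ω => U (ξ' ω) :=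
    eExp_congr_ae (hae.mono fun ω hω => by simp only [hω])
  rw [e]
  refine le_eExp_of_antitone hgi hanti (fun n => ?_)
    ((measurable_utility hU.toIsUtility).comp hξ').aemeasurable
    (ae_of_all _ fun ω n => hmajW n ω _) (ae_of_all _ fun ω t ht => ?_)
  · refine (h (W n) (D n) (hW n) (hD n) (hbd n) (hmajW n)).trans_eq (integral_congr_ae ?_)
    exact hae.mono fun ω hω => by simp only [hω]
  · obtain ⟨k, hk⟩ := henv _ t ht
    exact ⟨k, (hmin k ω).trans_lt hk⟩

/-- `dualUtility U w ≤ D` means that `D` is the intercept of an affine majorant of slope `w`. -/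
theorem dualUtility_le_coe_iff (hU : IsUtility U) (w D : ℝ) :
    dualUtility U w ≤ D ↔ ∀ z : ℝ, U z ≤ (D + w * z : ℝ) := by
  rw [dualUtility, concaveConj, EReal.neg_le, le_iInf_iff]
  refine forall_congr' fun z => ?_
  have := hU.lt_top z
  generalize U z = e at *
  induction e with
  | bot =>
    rw [EReal.sub_bot (EReal.coe_ne_bot _)]
    simp
  | coe u =>
    rw [← EReal.coe_sub, ← EReal.coe_neg, EReal.coe_le_coe_iff, EReal.coe_le_coe_iff]
    constructor <;> intro h <;> nlinarith
  | top => exact absurd this (lt_irrefl _)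

theorem dualUtility_nonneg (hU : IsNormalizedUtility U) (w : ℝ) : 0 ≤ dualUtility U w := by
  rw [dualUtility, EReal.le_neg, neg_zero]
  exact (iInf_le _ 0).trans (by simp [hU.map_zero])

theorem measurable_dualUtility (hU : IsUtility U) : Measurable (dualUtility U) := by
  have h : UpperSemicontinuous (concaveConj U) := by
    refine upperSemicontinuous_iInf fun x => ?_
    have := hU.lt_top x
    generalize U x = e at *
    induction e with
    | bot => simpa using! (upperSemicontinuous_const : UpperSemicontinuous fun _ : ℝ => (⊤ : EReal))
    | coe u =>
      refine Continuous.upperSemicontinuous ?_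
      simp only [← EReal.coe_sub]
      exact continuous_coe_real_ereal.comp (by fun_prop)
    | top => exact absurd this (lt_irrefl _)
  exact h.measurable.neg

/-- A finite dual functional is the expectation of an integrable choice of intercepts of affine
majorants. -/
theorem exists_integrable_majorant (hU : IsNormalizedUtility U) {W : Ω → ℝ}
    (hW : AEMeasurable W P) (h : intFun P (dualUtility U) W ≠ ⊤) :
    ∃ D : Ω → ℝ, Integrable D P ∧ (∀ᵐ ω ∂P, ∀ z : ℝ, U z ≤ (D ω + W ω * z : ℝ)) ∧
      intFun P (dualUtility U) W = ((∫ ω, D ω ∂P : ℝ) : EReal) := by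
  have hm : AEMeasurable (fun ω => dualUtility U (W ω)) P :=
    (measurable_dualUtility hU.toIsUtility).comp_aemeasurable hW
  have hneg : ∀ ω, (-dualUtility U (W ω)).toENNReal = 0 := fun ω =>
    EReal.toENNReal_of_nonpos (by simpa [EReal.neg_le] using dualUtility_nonneg hU (W ω))
  have hfin : ∫⁻ ω, (dualUtility U (W ω)).toENNReal ∂P ≠ ⊤ := by
    intro htop
    apply h
    simp [intFun, eExp, hneg, htop]
  have hlt := ae_lt_top' hm.ereal_toENNReal hfin
  have hi : Integrable (fun ω => (dualUtility U (W ω)).toReal) P := by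
    refine (integrable_toReal_of_lintegral_ne_top hm.ereal_toENNReal hfin).congr
      (ae_of_all _ fun ω => ?_)
    exact EReal.toReal_toENNReal (dualUtility_nonneg hU _)
  have hcoe : ∀ᵐ ω ∂P, dualUtility U (W ω) = ((dualUtility U (W ω)).toReal : EReal) := by
    filter_upwards [hlt] with ω hω
    refine (EReal.coe_toReal (EReal.toENNReal_ne_top_iff.1 hω.ne) ?_).symm
    exact ne_bot_of_le_ne_bot (by simp) (dualUtility_nonneg hU (W ω))
  refine ⟨_, hi, ?_, ?_⟩
  · filter_upwards [hcoe] with ω hω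
    exact (dualUtility_le_coe_iff hU.toIsUtility _ _).1 hω.le
  · rw [← eExp_coe hi]
    exact eExp_congr_ae hcoe

theorem intFun_dualUtility_le (hU : IsNormalizedUtility U) {W D : Ω → ℝ} (hD : Integrable D P)
    (h : ∀ᵐ ω ∂P, ∀ z : ℝ, U z ≤ (D ω + W ω * z : ℝ)) :
    intFun P (dualUtility U) W ≤ ((∫ ω, D ω ∂P : ℝ) : EReal) := by
  rw [← eExp_coe hD]
  exact eExp_mono_ae (h.mono fun ω hω => (dualUtility_le_coe_iff hU.toIsUtility _ _).2 hω)

theorem intFun_le_of_majorant {W D ξ : Ω → ℝ} (hD : Integrable D P)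
    (hWξ : Integrable (fun ω => W ω * ξ ω) P)
    (h : ∀ᵐ ω ∂P, ∀ z : ℝ, U z ≤ (D ω + W ω * z : ℝ)) :
    intFun P U ξ ≤ ((∫ ω, D ω ∂P + ∫ ω, W ω * ξ ω ∂P : ℝ) : EReal) := by
  rw [← integral_add hD hWξ]
  refine le_of_le_of_eq ?_ (eExp_coe (hD.add hWξ))
  exact eExp_mono_ae (h.mono fun ω hω => hω _)

end Expectation

/-! ### The Orlicz heart and its gauge seminorm -/

section Heart

variable {Ω : Type*} {mΩ : MeasurableSpace Ω} {P : Measure Ω} {U : ℝ → EReal}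

theorem aemeasurable_youngV_comp {X : Ω → ℝ} (hX : AEMeasurable X P) :
    AEMeasurable (fun ω => youngV U (X ω)) P :=
  (measurable_youngV U).comp_aemeasurable hX

theorem aemeasurable_youngU_comp (hU : IsUtility U) {X : Ω → ℝ} (hX : AEMeasurable X P) :
    AEMeasurable (fun ω => youngU U (X ω)) P :=
  (measurable_youngU hU).comp_aemeasurable hX

theorem MemHeart.add {X Y : Ω → ℝ} (hX : MemHeart (youngV U) P X) (hY : MemHeart (youngV U) P Y) :
    MemHeart (youngV U) P (X + Y) := by
  refine ⟨hX.1.add hY.1, fun c hc => ?_⟩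
  have h1 : ∀ ω, youngV U (c * (X + Y) ω) ≤
      youngV U (2 * c * X ω) + youngV U (2 * c * Y ω) := by
    intro ω
    have h2 : c * (X + Y) ω = (1 / 2) * (2 * c * X ω) + (1 / 2) * (2 * c * Y ω) := by
      simp only [Pi.add_apply]; ring
    rw [h2]
    refine (youngV_convex U (by norm_num) (by norm_num) (by norm_num) _ _).trans ?_
    have : ENNReal.ofReal (1 / 2) ≤ 1 := by
      rw [← ENNReal.ofReal_one]; exact ENNReal.ofReal_le_ofReal (by norm_num)
    exact add_le_add (mul_le_of_le_one_left' this) (mul_le_of_le_one_left' this)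
  refine (lintegral_mono h1).trans_lt ?_
  rw [lintegral_add_left' (aemeasurable_youngV_comp (hX.1.const_mul _))]
  exact ENNReal.add_lt_top.2 ⟨hX.2 _ (by positivity), hY.2 _ (by positivity)⟩

theorem MemHeart.smul {X : Ω → ℝ} (hX : MemHeart (youngV U) P X) (a : ℝ) :
    MemHeart (youngV U) P (a • X) := by
  refine ⟨hX.1.const_smul a, fun c hc => ?_⟩
  refine lt_of_le_of_lt (lintegral_mono fun ω => ?_) (hX.2 (c * |a|) (by positivity))
  refine youngV_mono_abs U (le_of_eq ?_)
  simp only [Pi.smul_apply, smul_eq_mul, abs_mul, abs_abs]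
  ring

variable (U P) in
/-- The Orlicz heart of `youngV U`, as a space of functions; almost surely equal functions are not
identified. -/
def orliczHeart : Submodule ℝ (Ω → ℝ) where
  carrier := {X | MemHeart (youngV U) P X}
  add_mem' := MemHeart.add
  zero_mem' := ⟨aemeasurable_const, fun c _ => by simp [youngV_zero]⟩
  smul_mem' a _ h := h.smul a

theorem MemHeart.of_abs_le {X Y : Ω → ℝ} (hX : MemHeart (youngV U) P X) (hY : AEMeasurable Y P)
    (h : ∀ᵐ ω ∂P, |Y ω| ≤ |X ω|) : MemHeart (youngV U) P Y := by
  refine ⟨hY, fun c hc => lt_of_le_of_lt (lintegral_mono_ae (h.mono fun ω hω => ?_)) (hX.2 c hc)⟩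
  exact youngV_mono_abs U (by rw [abs_mul, abs_mul]; gcongr)

theorem memHeart_of_bound [IsFiniteMeasure P] (hSL : IsSuperlinear U) {Y : Ω → ℝ}
    (hY : AEMeasurable Y P) {M : ℝ} (h : ∀ ω, |Y ω| ≤ M) : MemHeart (youngV U) P Y := by
  have h1 : MemHeart (youngV U) P fun _ => M := by
    refine ⟨aemeasurable_const, fun c _ => ?_⟩
    rw [lintegral_const]
    exact ENNReal.mul_lt_top (youngV_lt_top hSL _) (measure_lt_top _ _)
  exact h1.of_abs_le hY (ae_of_all _ fun ω => (h ω).trans (le_abs_self M))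

variable (U P) in
/-- The modular unit ball, whose gauge is the Luxemburg norm. -/
def modularBall : Set (orliczHeart P U) := {Z | ∫⁻ ω, youngV U ((Z : Ω → ℝ) ω) ∂P ≤ 1}

theorem smul_mem_modularBall_iff {Z : orliczHeart P U} {a : ℝ} :
    a • Z ∈ modularBall P U ↔ ∫⁻ ω, youngV U (a * (Z : Ω → ℝ) ω) ∂P ≤ 1 := Iff.rfl

theorem smul_mem_modularBall_of_abs_le {Z : orliczHeart P U} {a b : ℝ}
    (hb : b • Z ∈ modularBall P U) (h : |a| ≤ |b|) : a • Z ∈ modularBall P U := by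
  rw [smul_mem_modularBall_iff] at hb ⊢
  have h1 : ∀ ω, youngV U (a * (Z : Ω → ℝ) ω) ≤ youngV U (b * (Z : Ω → ℝ) ω) := by
    intro ω
    apply youngV_mono_abs
    rw [abs_mul, abs_mul]
    exact mul_le_mul_of_nonneg_right h (abs_nonneg _)
  exact (lintegral_mono h1).trans hb

theorem balanced_modularBall : Balanced ℝ (modularBall P U) := by
  rintro a ha _ ⟨Z, hZ, rfl⟩
  refine (lintegral_mono fun ω => youngV_mono_abs U ?_).trans hZ
  have ha : |a| ≤ 1 := ha
  simp only [Submodule.coe_smul, Pi.smul_apply, smul_eq_mul, abs_mul]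
  exact mul_le_of_le_one_left (abs_nonneg _) ha

theorem convex_modularBall : Convex ℝ (modularBall P U) := by
  intro Z hZ W hW a b ha hb hab
  have hZm := aemeasurable_youngV_comp (U := U) Z.2.1
  have hWm := aemeasurable_youngV_comp (U := U) W.2.1
  calc ∫⁻ ω, youngV U (((a • Z + b • W : orliczHeart P U) : Ω → ℝ) ω) ∂P
      ≤ ∫⁻ ω, (ENNReal.ofReal a * youngV U ((Z : Ω → ℝ) ω)
          + ENNReal.ofReal b * youngV U ((W : Ω → ℝ) ω)) ∂P :=
        lintegral_mono fun ω => youngV_convex U ha hb hab _ _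
    _ = ENNReal.ofReal a * ∫⁻ ω, youngV U ((Z : Ω → ℝ) ω) ∂P
          + ENNReal.ofReal b * ∫⁻ ω, youngV U ((W : Ω → ℝ) ω) ∂P := by
        rw [lintegral_add_left' (hZm.const_mul _), lintegral_const_mul'' _ hZm,
          lintegral_const_mul'' _ hWm]
    _ ≤ ENNReal.ofReal a * 1 + ENNReal.ofReal b * 1 := by gcongr <;> assumption
    _ = 1 := by rw [mul_one, mul_one, ← ENNReal.ofReal_add ha hb, hab, ENNReal.ofReal_one]

theorem inv_smul_mem_modularBall (Z : orliczHeart P U) :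
    ((∫⁻ ω, youngV U ((Z : Ω → ℝ) ω) ∂P).toReal + 1)⁻¹ • Z ∈ modularBall P U := by
  have hfin : ∫⁻ ω, youngV U ((Z : Ω → ℝ) ω) ∂P < ⊤ := by
    simpa using Z.2.2 1 zero_le_one
  set m := (∫⁻ ω, youngV U ((Z : Ω → ℝ) ω) ∂P).toReal with hm
  have hm0 : 0 ≤ m := ENNReal.toReal_nonneg
  have hk : (m + 1)⁻¹ ≤ 1 := inv_le_one_of_one_le₀ (by linarith)
  rw [smul_mem_modularBall_iff]
  calc ∫⁻ ω, youngV U ((m + 1)⁻¹ * (Z : Ω → ℝ) ω) ∂P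
      ≤ ∫⁻ ω, ENNReal.ofReal (m + 1)⁻¹ * youngV U ((Z : Ω → ℝ) ω) ∂P :=
        lintegral_mono fun ω => youngV_smul_le U (by positivity) hk _
    _ = ENNReal.ofReal (m + 1)⁻¹ * ENNReal.ofReal m := by
        rw [lintegral_const_mul'' _ (aemeasurable_youngV_comp Z.2.1), hm,
          ENNReal.ofReal_toReal hfin.ne]
    _ ≤ 1 := by
        rw [← ENNReal.ofReal_mul (by positivity), ← ENNReal.ofReal_one]
        refine ENNReal.ofReal_le_ofReal ?_
        rw [inv_mul_le_iff₀ (by linarith)]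
        linarith

theorem absorbent_modularBall : Absorbent ℝ (modularBall P U) := by
  intro Z
  have h1 := inv_smul_mem_modularBall Z
  set k := (∫⁻ ω, youngV U ((Z : Ω → ℝ) ω) ∂P).toReal + 1
  have hk : 0 < k := by positivity
  refine absorbs_iff_norm.2 ⟨k, fun a ha => ?_⟩
  rw [Real.norm_eq_abs] at ha
  have ha0 : a ≠ 0 := abs_pos.1 (hk.trans_le ha)
  rw [singleton_subset_iff, mem_smul_set_iff_inv_smul_mem₀ ha0]
  refine smul_mem_modularBall_of_abs_le h1 ?_
  rw [abs_inv, abs_inv, abs_of_pos hk]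
  exact inv_anti₀ hk ha

variable (U P) in
/-- The Luxemburg norm on the Orlicz heart, as a seminorm. -/
noncomputable def luxemburg : Seminorm ℝ (orliczHeart P U) :=
  gaugeSeminorm balanced_modularBall convex_modularBall absorbent_modularBall

theorem luxemburg_eq (Z : orliczHeart P U) : luxemburg P U Z = gaugeNorm (youngV U) P Z := by
  rw [luxemburg, gaugeSeminorm_toFun, gauge_def', gaugeNorm]
  congr 1
  ext c
  simp only [modularBall, mem_ofPred_eq, mem_Ioi, Submodule.coe_smul, Pi.smul_apply, smul_eq_mul,
    div_eq_inv_mul]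

theorem luxemburg_le_of_modular_le {Z : orliczHeart P U} {c : ℝ} (hc : 0 < c)
    (h : ∫⁻ ω, youngV U (c⁻¹ * (Z : Ω → ℝ) ω) ∂P ≤ 1) : luxemburg P U Z ≤ c := by
  refine gauge_le_of_mem hc.le ?_
  rw [mem_smul_set_iff_inv_smul_mem₀ hc.ne']
  exact smul_mem_modularBall_iff.2 h

theorem luxemburg_le_modular_add_one (Z : orliczHeart P U) :
    luxemburg P U Z ≤ (∫⁻ ω, youngV U ((Z : Ω → ℝ) ω) ∂P).toReal + 1 :=
  luxemburg_le_of_modular_le (by positivity)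
    (smul_mem_modularBall_iff.1 (inv_smul_mem_modularBall Z))

theorem modular_le_of_luxemburg_lt {Z : orliczHeart P U} {c : ℝ} (h : luxemburg P U Z < c) :
    ∫⁻ ω, youngV U (c⁻¹ * (Z : Ω → ℝ) ω) ∂P ≤ 1 := by
  rw [luxemburg_eq, gaugeNorm] at h
  have hne : {c : ℝ | 0 < c ∧ ∫⁻ ω, youngV U ((Z : Ω → ℝ) ω / c) ∂P ≤ 1}.Nonempty := by
    have hZ := inv_smul_mem_modularBall Z
    rw [smul_mem_modularBall_iff] at hZ
    simp only [← div_eq_inv_mul] at hZ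
    exact ⟨_, by positivity, hZ⟩
  obtain ⟨b, ⟨hb, hZ⟩, hbc⟩ := exists_lt_of_csInf_lt hne h
  simp only [div_eq_inv_mul] at hZ
  rw [← smul_mem_modularBall_iff] at hZ ⊢
  refine smul_mem_modularBall_of_abs_le hZ ?_
  rw [abs_inv, abs_inv, abs_of_pos hb, abs_of_pos (hb.trans hbc)]
  exact inv_anti₀ hb hbc.le

/-- Order continuity of the Luxemburg norm on the Orlicz heart. -/
theorem tendsto_luxemburg_zero (hSL : IsSuperlinear U) {ι : Type*} {l : Filter ι}
    [l.IsCountablyGenerated] {Z : ι → orliczHeart P U} {X : Ω → ℝ} (hX : MemHeart (youngV U) P X)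
    (hZX : ∀ i, ∀ᵐ ω ∂P, |(Z i : Ω → ℝ) ω| ≤ |X ω|)
    (hZ : ∀ᵐ ω ∂P, Tendsto (fun i => (Z i : Ω → ℝ) ω) l (𝓝 0)) :
    Tendsto (fun i => luxemburg P U (Z i)) l (𝓝 0) := by
  have hcont : Tendsto (youngV U) (𝓝 0) (𝓝 0) := by
    have h1 : Tendsto (fun y : ℝ => ENNReal.ofReal |y| * youngV U 1) (𝓝 0) (𝓝 0) := by
      have h2 : Tendsto (fun y : ℝ => ENNReal.ofReal |y|) (𝓝 0) (𝓝 0) := by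
        have : Continuous fun y : ℝ => ENNReal.ofReal |y| :=
          ENNReal.continuous_ofReal.comp continuous_abs
        simpa using this.tendsto 0
      simpa using ENNReal.Tendsto.mul_const h2 (Or.inr (youngV_lt_top hSL 1).ne)
    refine tendsto_of_tendsto_of_tendsto_of_le_of_le' tendsto_const_nhds h1
      (Eventually.of_forall fun _ => zero_le) ?_
    filter_upwards [Metric.ball_mem_nhds (0 : ℝ) one_pos] with y hy
    have hy : |y| < 1 := by simpa using hy
    have := youngV_smul_le U (abs_nonneg y) hy.le 1
    rw [mul_one] at this
    exact (youngV_mono_abs U (by simp)).trans this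
  rw [Metric.tendsto_nhds]
  intro ε hε
  have hc : (0 : ℝ) ≤ (ε / 2)⁻¹ := by positivity
  have hlim : Tendsto (fun i => ∫⁻ ω, youngV U ((ε / 2)⁻¹ * (Z i : Ω → ℝ) ω) ∂P) l (𝓝 0) := by
    have := tendsto_lintegral_filter_of_dominated_convergence' (μ := P) (l := l)
      (F := fun i ω => youngV U ((ε / 2)⁻¹ * (Z i : Ω → ℝ) ω)) (f := fun _ => 0)
      (fun ω => youngV U ((ε / 2)⁻¹ * X ω))
      (Eventually.of_forall fun i => aemeasurable_youngV_comp ((Z i).2.1.const_mul _))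
      (Eventually.of_forall fun i => (hZX i).mono fun ω hω =>
        youngV_mono_abs U (by rw [abs_mul, abs_mul]; gcongr))
      (hX.2 _ hc).ne
      (hZ.mono fun ω hω => hcont.comp (by simpa using hω.const_mul (ε / 2)⁻¹))
    simpa using this
  filter_upwards [hlim.eventually (gt_mem_nhds zero_lt_one)] with i hi
  have := luxemburg_le_of_modular_le (half_pos hε) hi.le
  have h0 : 0 ≤ luxemburg P U (Z i) := apply_nonneg _ _
  rw [Real.dist_eq, sub_zero, abs_of_nonneg h0]
  linarith

/-! ### The pairing of the Orlicz space with the Orlicz heart -/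

theorem MemOrlicz.add (hU : IsUtility U) {X Y : Ω → ℝ} (hX : MemOrlicz (youngU U) P X)
    (hY : MemOrlicz (youngU U) P Y) : MemOrlicz (youngU U) P (X + Y) := by
  obtain ⟨hXm, a, ha, hXa⟩ := hX
  obtain ⟨hYm, b, hb, hYb⟩ := hY
  refine ⟨hXm.add hYm, min a b / 2, by positivity, ?_⟩
  have hmono : ∀ {x y : ℝ}, |x| ≤ |y| → youngU U x ≤ youngU U y := fun h =>
    EReal.toENNReal_le_toENNReal (EReal.neg_le_neg_iff.2 (hU.mono (neg_le_neg h)))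
  have h1 : ∀ ω, youngU U (min a b / 2 * (X + Y) ω) ≤
      youngU U (a * X ω) + youngU U (b * Y ω) := by
    intro ω
    have key : ∀ s t : ℝ, |t| ≤ |s| → |min a b / 2 * (s + t)| ≤ min a b * |s| := by
      intro s t hst
      rw [abs_mul, abs_of_nonneg (by positivity)]
      have := abs_add_le s t
      have h0 : 0 < min a b := lt_min ha hb
      nlinarith
    rcases le_total |Y ω| |X ω| with h | h
    · refine le_add_right (hmono ((key _ _ h).trans ?_))
      rw [abs_mul, abs_of_pos ha]
      gcongr
      exact min_le_left _ _
    · refine le_add_left (hmono ?_)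
      rw [Pi.add_apply, add_comm]
      refine (key _ _ h).trans ?_
      rw [abs_mul, abs_of_pos hb]
      gcongr
      exact min_le_right _ _
  refine (lintegral_mono h1).trans_lt ?_
  rw [lintegral_add_left' (aemeasurable_youngU_comp hU (hXm.const_mul a))]
  exact ENNReal.add_lt_top.2 ⟨hXa, hYb⟩

theorem integrable_mul_of_memOrlicz (hU : IsUtility U) {X Y : Ω → ℝ}
    (hX : MemOrlicz (youngU U) P X) (hY : MemHeart (youngV U) P Y) :
    Integrable (fun ω => X ω * Y ω) P := by
  obtain ⟨hXm, a, ha, hXa⟩ := hX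
  have h1 : Integrable (fun ω => (a * X ω) * Y ω) P := by
    refine ⟨((hXm.const_mul a).mul hY.1).aestronglyMeasurable, ?_⟩
    rw [hasFiniteIntegral_iff_norm]
    have h2 := hY.2 1 zero_le_one
    simp only [one_mul] at h2
    refine (lintegral_mono fun ω =>
      ofReal_abs_mul_le_youngU_add_youngV U (a * X ω) (Y ω)).trans_lt ?_
    rw [lintegral_add_left' (aemeasurable_youngU_comp hU (hXm.const_mul a))]
    exact ENNReal.add_lt_top.2 ⟨hXa, h2⟩
  refine (h1.const_mul a⁻¹).congr (ae_of_all _ fun ω => ?_)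
  field_simp

/-- Elements of the Orlicz space are bounded functionals on the Orlicz heart. -/
theorem exists_pairing_bound (hU : IsUtility U) {X : Ω → ℝ} (hX : MemOrlicz (youngU U) P X) :
    ∃ C : ℝ, 0 ≤ C ∧ ∀ Z : orliczHeart P U,
      |∫ ω, X ω * (Z : Ω → ℝ) ω ∂P| ≤ C * luxemburg P U Z := by
  obtain ⟨hXm, a, ha, hXa⟩ := id hX
  set m := (∫⁻ ω, youngU U (a * X ω) ∂P).toReal
  refine ⟨(m + 1) / a, by positivity, fun Z => ?_⟩
  have key : ∀ c, luxemburg P U Z < c →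
      |∫ ω, X ω * (Z : Ω → ℝ) ω ∂P| ≤ (m + 1) / a * c := by
    intro c hc
    have hc0 : 0 < c := (apply_nonneg (luxemburg P U) Z).trans_lt hc
    have hmod := modular_le_of_luxemburg_lt hc
    have hi : Integrable (fun ω => (a * X ω) * (c⁻¹ * (Z : Ω → ℝ) ω)) P := by
      refine ((integrable_mul_of_memOrlicz hU hX Z.2).const_mul (a * c⁻¹)).congr
        (ae_of_all _ fun ω => ?_)
      ring
    have h1 : ∫ ω, |(a * X ω) * (c⁻¹ * (Z : Ω → ℝ) ω)| ∂P ≤ m + 1 := by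
      rw [integral_eq_lintegral_of_nonneg_ae (ae_of_all _ fun _ => abs_nonneg _)
        hi.norm.aestronglyMeasurable]
      have h2 : ∫⁻ ω, ENNReal.ofReal |(a * X ω) * (c⁻¹ * (Z : Ω → ℝ) ω)| ∂P ≤
          ENNReal.ofReal m + 1 := by
        refine (lintegral_mono fun ω => ofReal_abs_mul_le_youngU_add_youngV U _ _).trans ?_
        rw [lintegral_add_left' (aemeasurable_youngU_comp hU (hXm.const_mul a)),
          ENNReal.ofReal_toReal hXa.ne]
        gcongr
      refine ENNReal.toReal_le_of_le_ofReal (by positivity) (h2.trans_eq ?_)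
      rw [ENNReal.ofReal_add (by positivity) zero_le_one, ENNReal.ofReal_one]
    have h3 : ∫ ω, (a * X ω) * (c⁻¹ * (Z : Ω → ℝ) ω) ∂P =
        a * c⁻¹ * ∫ ω, X ω * (Z : Ω → ℝ) ω ∂P := by
      rw [← integral_const_mul]
      congr 1; funext ω; ring
    have h4 := (abs_integral_le_integral_abs (f := fun ω => (a * X ω) * (c⁻¹ * (Z : Ω → ℝ) ω))
      (μ := P)).trans h1
    rw [h3, abs_mul, abs_of_pos (by positivity)] at h4
    rw [div_mul_eq_mul_div, le_div_iff₀ ha]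
    have h5 : a * c⁻¹ * |∫ ω, X ω * (Z : Ω → ℝ) ω ∂P| * c =
      |∫ ω, X ω * (Z : Ω → ℝ) ω ∂P| * a := by field_simp
    rw [← h5]
    gcongr
  have hlim : Tendsto (fun c : ℝ => (m + 1) / a * c) (𝓝[>] (luxemburg P U Z))
      (𝓝 ((m + 1) / a * luxemburg P U Z)) :=
    ((continuous_const.mul continuous_id).tendsto _).mono_left nhdsWithin_le_nhds
  exact ge_of_tendsto hlim (eventually_mem_nhdsWithin.mono fun c hc => key c hc)

end Heart

/-! ### A linear minorant for a convex set of pairs -/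

/-- If a convex set in `E × ℝ` lies above the concave function `r - K * p`, some `p`-bounded affine
function with value `r` at the origin separates the two. -/
theorem Seminorm.exists_affine_minorant {E : Type*} [AddCommGroup E] [Module ℝ E]
    (p : Seminorm ℝ E) {A : Set (E × ℝ)} (hA : Convex ℝ A) {r K : ℝ} (hK : 0 ≤ K)
    (h : ∀ q ∈ A, r - K * p q.1 ≤ q.2) :
    ∃ (f : E →ₗ[ℝ] ℝ) (C : ℝ), 0 ≤ C ∧ (∀ Z, |f Z| ≤ C * p Z) ∧ ∀ q ∈ A, r + f q.1 ≤ q.2 := by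
  rcases A.eq_empty_or_nonempty with rfl | ⟨q₀, hq₀⟩
  · exact ⟨0, 0, le_rfl, by simp, by simp⟩
  let _ : SeminormedAddCommGroup E := p.toAddGroupSeminorm.toSeminormedAddCommGroup
  let _ : NormedSpace ℝ E := { norm_smul_le := fun a x => (map_smul_eq_mul p a x).le }
  have hn : ∀ x : E, ‖x‖ = p x := fun _ => rfl
  have hO : IsOpen {q : E × ℝ | q.2 < r - K * ‖q.1‖} := isOpen_lt (by fun_prop) (by fun_prop)
  have hOc : Convex ℝ {q : E × ℝ | q.2 < r - K * ‖q.1‖} := by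
    have h1 : ConcaveOn ℝ univ fun x : E => r - K * ‖x‖ := by
      exact (concaveOn_const r convex_univ).sub ((convexOn_univ_norm (E := E)).smul hK)
    simpa using h1.convex_strict_hypograph
  obtain ⟨F, u, hF, hu⟩ := geometric_hahn_banach_open hOc hO hA
    (disjoint_left.2 fun q hq hqA => (h q hqA).not_gt hq)
  have hFe : ∀ (x : E) (t : ℝ), F (x, t) = F (x, 0) + F (0, 1) * t := by
    intro x t
    have : ((x, t) : E × ℝ) = (x, 0) + t • (0, 1) := by simp
    rw [this, map_add, map_smul, smul_eq_mul, mul_comm]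
  set b := F (0, 1) with hb
  have hb0 : 0 < b := by
    have h1 := hF (q₀.1, r - K * ‖q₀.1‖ - 1) (by simp)
    have h2 := hu (q₀.1, q₀.2) hq₀
    have h3 := h q₀ hq₀
    rw [← hn] at h3
    rw [hFe] at h1 h2
    have h4 : b * (r - K * ‖q₀.1‖ - 1) < b * q₀.2 := by linarith
    by_contra! hneg
    nlinarith
  have hbr : b * r ≤ u := by
    refine le_of_forall_pos_lt_add fun ε hε => ?_
    have h1 := hF (0, r - ε / b) (by simp; positivity)
    rw [hFe, mul_sub, mul_div_cancel₀ _ hb0.ne'] at h1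
    have h2 : F ((0 : E), (0 : ℝ)) = 0 := map_zero F
    linarith
  set g : E →L[ℝ] ℝ := F.comp (ContinuousLinearMap.inl ℝ E ℝ) with hg
  have hge : ∀ x, F (x, 0) = g x := fun _ => rfl
  refine ⟨(-b⁻¹) • (g : E →ₗ[ℝ] ℝ), b⁻¹ * ‖g‖, by positivity, fun Z => ?_, fun q hq => ?_⟩
  · have h1 := g.le_opNorm Z
    rw [hn, Real.norm_eq_abs] at h1
    simp only [LinearMap.smul_apply, smul_eq_mul, ContinuousLinearMap.coe_coe, abs_mul, abs_neg,
      abs_of_pos (inv_pos.2 hb0), mul_assoc]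
    gcongr
  · have h1 := hu (q.1, q.2) hq
    rw [hFe, hge] at h1
    simp only [LinearMap.smul_apply, smul_eq_mul, ContinuousLinearMap.coe_coe]
    have h2 : r + -b⁻¹ * g q.1 = (b * r - g q.1) / b := by
      field_simp
      ring
    rw [h2, div_le_iff₀ hb0]
    linarith

/-! ### Representation of bounded functionals on the Orlicz heart -/

section Representation

variable {Ω : Type*} {mΩ : MeasurableSpace Ω} {P : Measure Ω} {U : ℝ → EReal}

/-- A linear functional is order continuous on the Orlicz heart if it is bounded there. -/
theorem tendsto_zero_of_luxemburg_bound (hSL : IsSuperlinear U) {F : (Ω → ℝ) →ₗ[ℝ] ℝ} {C : ℝ}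
    (hF : ∀ Z : orliczHeart P U, |F Z| ≤ C * luxemburg P U Z) {ι : Type*} {l : Filter ι}
    [l.IsCountablyGenerated] {Z : ι → Ω → ℝ} {X : Ω → ℝ} (hX : MemHeart (youngV U) P X)
    (hZm : ∀ i, AEMeasurable (Z i) P) (hZX : ∀ i, ∀ᵐ ω ∂P, |Z i ω| ≤ |X ω|)
    (hZ : ∀ᵐ ω ∂P, Tendsto (fun i => Z i ω) l (𝓝 0)) : Tendsto (fun i => F (Z i)) l (𝓝 0) := by
  have h1 := tendsto_luxemburg_zero (P := P) hSL (l := l)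
    (Z := fun i => ⟨Z i, hX.of_abs_le (hZm i) (hZX i)⟩) hX hZX hZ
  have h2 := h1.const_mul C
  rw [mul_zero] at h2
  exact squeeze_zero_norm (fun i => hF ⟨Z i, hX.of_abs_le (hZm i) (hZX i)⟩) h2

/-- The indicators of a disjoint sequence of sets sum up pointwise to the indicator of the union,
with remainders bounded by one. -/
theorem indicator_iUnion_sub_sum {A : ℕ → Set Ω} (hd : Pairwise (Function.onFun Disjoint A))
    (ω : Ω) :
    (∀ s : Finset ℕ, |(⋃ i, A i).indicator (1 : Ω → ℝ) ω
      - ∑ i ∈ s, (A i).indicator (1 : Ω → ℝ) ω| ≤ 1) ∧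
    Tendsto (fun s : Finset ℕ => (⋃ i, A i).indicator (1 : Ω → ℝ) ω
      - ∑ i ∈ s, (A i).indicator (1 : Ω → ℝ) ω) atTop (𝓝 0) := by
  by_cases hω : ∃ j, ω ∈ A j
  · obtain ⟨j, hj⟩ := hω
    have h1 : ∀ i, (A i).indicator (1 : Ω → ℝ) ω = if j = i then 1 else 0 := by
      intro i
      split_ifs with hij
      · subst hij; simp [hj]
      · exact indicator_of_notMem (fun hi => disjoint_left.1 (hd hij) hj hi) _
    have h2 : (⋃ i, A i).indicator (1 : Ω → ℝ) ω = 1 := by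
      rw [indicator_of_mem (mem_iUnion.2 ⟨j, hj⟩)]; rfl
    simp only [h1, h2, Finset.sum_ite_eq]
    refine ⟨fun s => by split_ifs <;> simp, tendsto_const_nhds.congr' ?_⟩
    filter_upwards [eventually_ge_atTop {j}] with s hs
    rw [if_pos (hs (Finset.mem_singleton_self j))]
    simp
  · push Not at hω
    have h1 : ∀ i, (A i).indicator (1 : Ω → ℝ) ω = 0 := fun i => indicator_of_notMem (hω i) _
    have h2 : (⋃ i, A i).indicator (1 : Ω → ℝ) ω = 0 :=
      indicator_of_notMem (by simpa using hω) _
    simp [h1, h2]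

/-- A density on simple functions is a density at every element of the heart with which its product
is integrable. -/
theorem eq_integral_of_simpleFunc (hSL : IsSuperlinear U) {F : (Ω → ℝ) →ₗ[ℝ] ℝ} {C : ℝ}
    (hF : ∀ Z : orliczHeart P U, |F Z| ≤ C * luxemburg P U Z) {X Z : Ω → ℝ} (hX : Measurable X)
    (hs : ∀ s : SimpleFunc Ω ℝ, F s = ∫ ω, X ω * s ω ∂P) (hZ : MemHeart (youngV U) P Z)
    (hXZ : Integrable (fun ω => X ω * Z ω) P) : F Z = ∫ ω, X ω * Z ω ∂P := by
  obtain ⟨Z', hZ', hae⟩ := id hZ.1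
  set s : ℕ → SimpleFunc Ω ℝ := SimpleFunc.approxOn Z' hZ' univ 0 (mem_univ 0) with hsdef
  have hsb : ∀ n ω, |s n ω| ≤ 2 * |Z' ω| := fun n ω => by
    have := SimpleFunc.norm_approxOn_zero_le hZ' (mem_univ 0) ω n
    simp only [Real.norm_eq_abs] at this
    linarith
  have hsl : ∀ ω, Tendsto (fun n => s n ω) atTop (𝓝 (Z' ω)) := fun ω =>
    SimpleFunc.tendsto_approxOn hZ' (mem_univ 0) (by simp)
  have h1 := tendsto_zero_of_luxemburg_bound hSL hF (l := (atTop : Filter ℕ))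
    (Z := fun n => Z - ⇑(s n)) (hZ.smul 3)
    (fun n => hZ.1.sub (s n).measurable.aemeasurable)
    (fun n => hae.mono fun ω hω => by
      have h2 := hsb n ω
      rw [← hω] at h2
      simp only [Pi.sub_apply, Pi.smul_apply, smul_eq_mul, abs_mul]
      refine (abs_sub _ _).trans ?_
      rw [abs_of_pos (by norm_num : (0 : ℝ) < 3)]
      linarith)
    (hae.mono fun ω hω => by
      have := (hsl ω).const_sub (Z ω)
      rwa [hω, sub_self, ← hω] at this)
  have h2 : Tendsto (fun n => F (s n)) atTop (𝓝 (F Z)) := by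
    simp only [map_sub] at h1
    simpa using h1.const_sub (F Z)
  have h3 : Tendsto (fun n => ∫ ω, X ω * s n ω ∂P) atTop (𝓝 (∫ ω, X ω * Z ω ∂P)) := by
    refine tendsto_integral_of_dominated_convergence (fun ω => 2 * |X ω * Z ω|)
      (fun n => (hX.mul (s n).measurable).aestronglyMeasurable) (hXZ.abs.const_mul 2)
      (fun n => hae.mono fun ω hω => ?_) (hae.mono fun ω hω => ?_)
    · have h2 := hsb n ω
      rw [Real.norm_eq_abs, abs_mul, abs_mul, hω]
      nlinarith [abs_nonneg (X ω)]
    · rw [hω]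
      exact (hsl ω).const_mul _
  exact tendsto_nhds_unique h2 (by simpa only [hs] using h3)

variable [IsFiniteMeasure P]

/-- A bounded functional on the Orlicz heart has an integrable density on simple functions: on
indicators it is a signed measure that is absolutely continuous with respect to `P`. -/
theorem exists_density_simpleFunc (hSL : IsSuperlinear U) {F : (Ω → ℝ) →ₗ[ℝ] ℝ} {C : ℝ}
    (hF : ∀ Z : orliczHeart P U, |F Z| ≤ C * luxemburg P U Z) :
    ∃ X : Ω → ℝ, Measurable X ∧ Integrable X P ∧
      ∀ s : SimpleFunc Ω ℝ, F s = ∫ ω, X ω * s ω ∂P := by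
  classical
  have h1h : MemHeart (youngV U) P (1 : Ω → ℝ) :=
    memHeart_of_bound hSL aemeasurable_const (M := 1) (by simp)
  let ν : SignedMeasure Ω :=
    { measureOf' := fun A => if MeasurableSet A then F (A.indicator 1) else 0
      empty' := by
        rw [if_pos MeasurableSet.empty, indicator_empty]
        exact map_zero F
      not_measurable' := fun A hA => if_neg hA
      m_iUnion' := by
        intro A hA hd
        have hm : ∀ i, Measurable ((A i).indicator (1 : Ω → ℝ)) :=
          fun i => measurable_one.indicator (hA i)
        have h1 := tendsto_zero_of_luxemburg_bound hSL hF (l := (atTop : Filter (Finset ℕ)))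
          (Z := fun s => (⋃ i, A i).indicator (1 : Ω → ℝ) - ∑ i ∈ s, (A i).indicator (1 : Ω → ℝ))
          h1h
          (fun s => by
            have h2 : Measurable (∑ i ∈ s, (A i).indicator (1 : Ω → ℝ)) := by
              rw [Finset.sum_fn]
              exact Finset.measurable_sum s fun i _ => hm i
            exact ((measurable_one.indicator (MeasurableSet.iUnion hA)).sub h2).aemeasurable)
          (fun s => ae_of_all _ fun ω => by
            simpa using (indicator_iUnion_sub_sum hd ω).1 s)
          (ae_of_all _ fun ω => by
            simpa using (indicator_iUnion_sub_sum hd ω).2)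
        simp only [map_sub, map_sum] at h1
        simp only [hA, MeasurableSet.iUnion hA, if_true]
        have h2 := h1.const_sub (F ((⋃ i, A i).indicator 1))
        simpa [HasSum] using h2 }
  have hν : ∀ A, MeasurableSet A → ν A = F (A.indicator 1) := fun A hA => if_pos hA
  have hac : ν ≪ᵥ P.toENNRealVectorMeasure := by
    refine VectorMeasure.AbsolutelyContinuous.mk fun A hA hPA => ?_
    rw [Measure.toENNRealVectorMeasure_apply_measurable hA] at hPA
    rw [hν A hA]
    have hz : ∀ᵐ ω ∂P, A.indicator (1 : Ω → ℝ) ω = 0 := by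
      filter_upwards [measure_eq_zero_iff_ae_notMem.1 hPA] with ω hω
      exact indicator_of_notMem hω _
    have h1 := tendsto_zero_of_luxemburg_bound hSL hF (l := (atTop : Filter ℕ))
      (Z := fun _ => A.indicator (1 : Ω → ℝ)) h1h
      (fun _ => (measurable_one.indicator hA).aemeasurable)
      (fun _ => hz.mono fun ω hω => by rw [hω]; simp)
      (hz.mono fun ω hω => by simp only [hω]; exact tendsto_const_nhds)
    exact tendsto_nhds_unique tendsto_const_nhds h1
  have hrn := SignedMeasure.withDensityᵥ_rnDeriv_eq ν P hac
  have hXi := SignedMeasure.integrable_rnDeriv ν P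
  refine ⟨ν.rnDeriv P, SignedMeasure.measurable_rnDeriv ν P, hXi, fun s => ?_⟩
  induction s using SimpleFunc.induction with
  | const c hA =>
    rename_i A
    have e1 : (⇑(SimpleFunc.piecewise A hA (SimpleFunc.const Ω c) (SimpleFunc.const Ω 0)) : Ω → ℝ)
        = c • A.indicator (1 : Ω → ℝ) := by
      funext ω
      by_cases hω : ω ∈ A <;> simp [hω]
    rw [e1, map_smul, ← hν A hA, ← hrn, withDensityᵥ_apply hXi hA, smul_eq_mul,
      ← integral_indicator hA, ← integral_const_mul, hrn]
    congr 1
    funext ω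
    by_cases hω : ω ∈ A <;> simp [hω, mul_comm]
  | add _ hs ht =>
    rename_i s t _
    have hint : ∀ s : SimpleFunc Ω ℝ, Integrable (fun ω => ν.rnDeriv P ω * s ω) P := by
      intro s
      obtain ⟨M, hM⟩ := s.exists_forall_norm_le
      exact hXi.mul_bdd s.aestronglyMeasurable (ae_of_all _ hM)
    rw [SimpleFunc.coe_add, map_add, hs, ht, ← integral_add (hint s) (hint t)]
    congr 1
    funext ω
    simp [mul_add]

/-- The dual of the Orlicz heart of the conjugate Young function is the Orlicz space. -/
theorem exists_memOrlicz_of_bounded (hU : IsNormalizedUtility U) (hSL : IsSuperlinear U)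
    {f : orliczHeart P U →ₗ[ℝ] ℝ} {C : ℝ} (hC : 0 ≤ C)
    (hf : ∀ Z, |f Z| ≤ C * luxemburg P U Z) :
    ∃ X : Ω → ℝ, MemOrlicz (youngU U) P X ∧
      ∀ Z : orliczHeart P U, f Z = ∫ ω, X ω * (Z : Ω → ℝ) ω ∂P := by
  -- an arbitrary linear extension to all functions; only its values on the heart matter
  obtain ⟨F, hFf⟩ := f.exists_extend
  have hFZ : ∀ Z : orliczHeart P U, F Z = f Z := fun Z => by rw [← hFf]; rfl
  have hF : ∀ Z : orliczHeart P U, |F Z| ≤ C * luxemburg P U Z := fun Z => by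
    rw [hFZ]; exact hf Z
  obtain ⟨X, hXm, hXi, hXs⟩ := exists_density_simpleFunc hSL hF
  have hC0 : 0 < C + 1 := by linarith
  have hXO : MemOrlicz (youngU U) P X := by
    refine ⟨hXm.aemeasurable, (C + 1)⁻¹, inv_pos.2 hC0, ?_⟩
    -- expected utility of `-|X| / (C + 1)` is at least `-1`
    have hlow : ((-1 : ℝ) : EReal) ≤ intFun P U fun ω => -|(C + 1)⁻¹ * X ω| := by
      refine le_intFun_of_forall_majorant hU (hXi.const_mul _).abs.neg ?_
      rintro W D hW hD ⟨M, hM⟩ hmaj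
      have hDi : Integrable D P :=
        Integrable.of_bound hD.aestronglyMeasurable M (ae_of_all _ fun ω => (hM ω).2)
      have hD0 : ∀ ω, 0 ≤ D ω := fun ω => hU.intercept_nonneg (hmaj ω)
      -- the sign is chosen so that `X * Z = W * |X|`; slopes `W` of majorants are nonnegative
      set Z : Ω → ℝ := fun ω => if 0 ≤ X ω then W ω else -W ω with hZdef
      have hZabs : ∀ ω, |Z ω| = |W ω| := by
        intro ω
        simp only [hZdef]
        split_ifs <;> simp
      have hXZ : ∀ ω, X ω * Z ω = W ω * |X ω| := by
        intro ω
        simp only [hZdef]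
        split_ifs with h
        · rw [abs_of_nonneg h]; ring
        · rw [abs_of_neg (not_le.1 h)]; ring
      have hZm : Measurable Z :=
        Measurable.ite (measurableSet_le measurable_const hXm) hW hW.neg
      have hZH : MemHeart (youngV U) P Z := memHeart_of_bound hSL hZm.aemeasurable
        (M := M) fun ω => by rw [hZabs]; exact (hM ω).1
      have hXZi : Integrable (fun ω => X ω * Z ω) P :=
        hXi.mul_bdd hZm.aestronglyMeasurable (c := M)
          (ae_of_all _ fun ω => by rw [Real.norm_eq_abs, hZabs]; exact (hM ω).1)
      have hmod : (∫⁻ ω, youngV U (Z ω) ∂P).toReal ≤ ∫ ω, D ω ∂P := by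
        refine ENNReal.toReal_le_of_le_ofReal (integral_nonneg fun ω => hD0 ω) ?_
        rw [ofReal_integral_eq_lintegral_ofReal hDi (ae_of_all _ hD0)]
        refine lintegral_mono fun ω => ?_
        exact (youngV_mono_abs U (hZabs ω).le).trans (youngV_le_intercept hU (hmaj ω))
      have h1 : ∫ ω, W ω * |X ω| ∂P ≤ (C + 1) * (∫ ω, D ω ∂P + 1) := by
        have h2 := eq_integral_of_simpleFunc hSL hF hXm hXs hZH hXZi
        simp only [hXZ] at h2
        rw [← h2]
        have h3 := (le_abs_self _).trans (hF ⟨Z, hZH⟩)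
        have h4 := luxemburg_le_modular_add_one (⟨Z, hZH⟩ : orliczHeart P U)
        have h5 : luxemburg P U ⟨Z, hZH⟩ ≤ ∫ ω, D ω ∂P + 1 := h4.trans (by linarith)
        have h6 : 0 ≤ ∫ ω, D ω ∂P := integral_nonneg fun ω => hD0 ω
        refine h3.trans ?_
        nlinarith [mul_le_mul_of_nonneg_left h5 hC]
      have hWXi : Integrable (fun ω => W ω * |X ω|) P := by simpa only [hXZ] using hXZi
      have h2 : (fun ω => D ω + W ω * (-|(C + 1)⁻¹ * X ω|)) =
          fun ω => D ω - (C + 1)⁻¹ * (W ω * |X ω|) := by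
        funext ω
        rw [abs_mul, abs_of_pos (inv_pos.2 hC0)]; ring
      refine le_of_le_of_eq ?_ (congrArg (fun g : Ω → ℝ => ∫ ω, g ω ∂P) h2.symm)
      rw [integral_sub hDi (hWXi.const_mul _), integral_const_mul]
      have h3 : (C + 1)⁻¹ * ∫ ω, W ω * |X ω| ∂P ≤ ∫ ω, D ω ∂P + 1 := by
        rw [inv_mul_le_iff₀ hC0]; exact h1
      linarith
    have h0 : ∀ ω, (U (-|(C + 1)⁻¹ * X ω|)).toENNReal = 0 := fun ω =>
      EReal.toENNReal_of_nonpos (hU.nonpos_of_nonpos (neg_nonpos.2 (abs_nonneg _)))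
    rw [lt_top_iff_ne_top]
    intro htop
    have htop' : ∫⁻ ω, (-U (-|(C + 1)⁻¹ * X ω|)).toENNReal ∂P = ⊤ := htop
    simp only [intFun, eExp, htop', h0] at hlow
    simp at hlow
    exact EReal.coe_ne_top 1 hlow
  refine ⟨X, hXO, fun Z => ?_⟩
  rw [← hFZ]
  exact eq_integral_of_simpleFunc hSL hF hXm hXs Z.2
    (integrable_mul_of_memOrlicz hU.toIsUtility hXO Z.2)

end Representation

/-! ### Duality for the utility maximization problem -/

section Duality

variable {Ω : Type*} {mΩ : MeasurableSpace Ω} {P : Measure Ω} {U : ℝ → EReal}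
  {C : Set (Ω → ℝ)} {B : Ω → ℝ}

theorem zero_mem_polarCone : (0 : Ω → ℝ) ∈ polarCone P U C :=
  ⟨(orliczHeart P U).zero_mem, fun X _ => by simp⟩

theorem add_mem_polarCone (hU : IsUtility U) (hC : ∀ X ∈ C, MemOrlicz (youngU U) P X)
    {Y Y' : Ω → ℝ} (hY : Y ∈ polarCone P U C) (hY' : Y' ∈ polarCone P U C) :
    Y + Y' ∈ polarCone P U C := by
  refine ⟨hY.1.add hY'.1, fun X hX => ?_⟩
  simp only [Pi.add_apply, mul_add]
  rw [integral_add (integrable_mul_of_memOrlicz hU (hC X hX) hY.1)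
    (integrable_mul_of_memOrlicz hU (hC X hX) hY'.1)]
  exact add_nonpos (hY.2 X hX) (hY'.2 X hX)

theorem smul_mem_polarCone {Y : Ω → ℝ} (hY : Y ∈ polarCone P U C) {a : ℝ} (ha : 0 ≤ a) :
    a • Y ∈ polarCone P U C := by
  refine ⟨hY.1.smul a, fun X hX => ?_⟩
  simp only [Pi.smul_apply, smul_eq_mul, mul_left_comm _ a]
  rw [integral_const_mul]
  exact mul_nonpos_of_nonneg_of_nonpos ha (hY.2 X hX)

/-- Weak duality with a perturbation of the dual variable. -/
theorem intFun_le_dual_add_pairing (hU : IsNormalizedUtility U)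
    (hC : ∀ X ∈ C, MemOrlicz (youngU U) P X) (hB : MemOrlicz (youngU U) P B) {X Y Z : Ω → ℝ}
    (hX : X ∈ C) (hY : Y ∈ polarCone P U C) (hZ : MemHeart (youngV U) P Z) :
    intFun P U (B + X) ≤ intFun P (dualUtility U) (Y + Z) +
      ((∫ ω, (Y ω + Z ω) * B ω ∂P : ℝ) : EReal) + ((∫ ω, X ω * Z ω ∂P : ℝ) : EReal) := by
  have hW := hY.1.add hZ
  have hUu := hU.toIsUtility
  by_cases htop : intFun P (dualUtility U) (Y + Z) = ⊤
  · rw [htop, EReal.top_add_coe, EReal.top_add_coe]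
    exact le_top
  obtain ⟨D, hD, hmaj, hDV⟩ := exists_integrable_majorant hU hW.1 htop
  have hi1 : Integrable (fun ω => (Y ω + Z ω) * B ω) P := by
    simpa only [mul_comm] using! integrable_mul_of_memOrlicz hUu hB hW
  have hi2 := integrable_mul_of_memOrlicz hUu (hC X hX) hY.1
  have hi3 := integrable_mul_of_memOrlicz hUu (hC X hX) hZ
  have e : (fun ω => (Y + Z) ω * (B + X) ω) =
      fun ω => (Y ω + Z ω) * B ω + (X ω * Y ω + X ω * Z ω) := by
    funext ω; simp only [Pi.add_apply]; ring
  have hi : Integrable (fun ω => (Y + Z) ω * (B + X) ω) P := by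
    rw [e]; exact hi1.add (hi2.add hi3)
  refine (intFun_le_of_majorant hD hi hmaj).trans ?_
  rw [hDV, ← EReal.coe_add, ← EReal.coe_add, EReal.coe_le_coe_iff, e]
  have h1 := integral_add hi1 (hi2.add hi3)
  have h2 := integral_add hi2 hi3
  simp only [Pi.add_apply] at h1
  rw [h1, h2]
  linarith [hY.2 X hX]

/-- The epigraph of the dual value function: pairs of a perturbation `Z` and a level dominating the
dual functional at some `Y + Z`, where `Y` is in the polar cone. The expectation of the dual utility
is encoded by an integrable choice `D` of intercepts of affine majorants of `U`, which makes
convexity immediate. -/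
def dualEpigraph (P : Measure Ω) (U : ℝ → EReal) (C : Set (Ω → ℝ)) (B : Ω → ℝ) :
    Set (orliczHeart P U × ℝ) :=
  {q | ∃ Y ∈ polarCone P U C, ∃ D : Ω → ℝ, Integrable D P ∧
    (∀ᵐ ω ∂P, ∀ z : ℝ, U z ≤ (D ω + (Y ω + (q.1 : Ω → ℝ) ω) * z : ℝ)) ∧
    ∫ ω, D ω ∂P + ∫ ω, (Y ω + (q.1 : Ω → ℝ) ω) * B ω ∂P ≤ q.2}

theorem convex_dualEpigraph (hU : IsUtility U) (hC : ∀ X ∈ C, MemOrlicz (youngU U) P X)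
    (hB : MemOrlicz (youngU U) P B) : Convex ℝ (dualEpigraph P U C B) := by
  rintro ⟨Z, t⟩ ⟨Y, hY, D, hD, hmaj, ht⟩ ⟨Z', t'⟩ ⟨Y', hY', D', hD', hmaj', ht'⟩ a b ha hb hab
  refine ⟨a • Y + b • Y', add_mem_polarCone hU hC (smul_mem_polarCone hY ha)
    (smul_mem_polarCone hY' hb), fun ω => a * D ω + b * D' ω,
    (hD.const_mul a).add (hD'.const_mul b), ?_, ?_⟩
  · filter_upwards [hmaj, hmaj'] with ω h1 h2 z
    refine hU.le_coe_of_forall fun u hu => ?_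
    have h1 := EReal.coe_le_coe_iff.1 (hu.trans (h1 z))
    have h2 := EReal.coe_le_coe_iff.1 (hu.trans (h2 z))
    have e : a * D ω + b * D' ω + ((a • Y + b • Y') ω +
        ((a • Z + b • Z' : orliczHeart P U) : Ω → ℝ) ω) * z =
        a * (D ω + (Y ω + (Z : Ω → ℝ) ω) * z) + b * (D' ω + (Y' ω + (Z' : Ω → ℝ) ω) * z) := by
      simp only [Pi.add_apply, Pi.smul_apply, smul_eq_mul, Submodule.coe_add, Submodule.coe_smul]
      ring
    have h3 : u = a * u + b * u := by rw [← add_mul, hab, one_mul]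
    refine le_of_le_of_eq ?_ e.symm
    rw [h3]
    gcongr
  · have hi1 : Integrable (fun ω => (Y ω + (Z : Ω → ℝ) ω) * B ω) P := by
      simpa only [mul_comm] using! integrable_mul_of_memOrlicz hU hB (hY.1.add Z.2)
    have hi2 : Integrable (fun ω => (Y' ω + (Z' : Ω → ℝ) ω) * B ω) P := by
      simpa only [mul_comm] using! integrable_mul_of_memOrlicz hU hB (hY'.1.add Z'.2)
    have e : (fun ω => ((a • Y + b • Y') ω +
        ((a • Z + b • Z' : orliczHeart P U) : Ω → ℝ) ω) * B ω) =
        fun ω => a * ((Y ω + (Z : Ω → ℝ) ω) * B ω) + b * ((Y' ω + (Z' : Ω → ℝ) ω) * B ω) := by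
      funext ω
      simp only [Pi.add_apply, Pi.smul_apply, smul_eq_mul, Submodule.coe_add, Submodule.coe_smul]
      ring
    have e' := congrArg (fun g : Ω → ℝ => ∫ ω, g ω ∂P) e
    have h1 : ∫ ω, (a * D ω + b * D' ω) ∂P = a * ∫ ω, D ω ∂P + b * ∫ ω, D' ω ∂P := by
      rw [integral_add (hD.const_mul a) (hD'.const_mul b), integral_const_mul, integral_const_mul]
    replace e' := e'.trans (integral_add (hi1.const_mul a) (hi2.const_mul b))
    rw [integral_const_mul, integral_const_mul] at e'
    change ∫ ω, (a * D ω + b * D' ω) ∂P + ∫ ω, ((a • Y + b • Y') ω +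
        ((a • Z + b • Z' : orliczHeart P U) : Ω → ℝ) ω) * B ω ∂P ≤ a * t + b * t'
    rw [h1, e']
    have := mul_le_mul_of_nonneg_left ht ha
    have := mul_le_mul_of_nonneg_left ht' hb
    simp only at *
    linarith

theorem exists_affine_majorant (hU : IsNormalizedUtility U) :
    ∃ y c : ℝ, ∀ z : ℝ, U z ≤ (c + y * z : ℝ) := by
  obtain ⟨y, c, h, -⟩ := hU.exists_affine_seq
  exact ⟨y 0, c 0, h 0⟩

/-- A lower bound of the perturbed dual problem near the zero perturbation is attained by the
primal problem over the bipolar cone. -/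
theorem exists_bipolar_le_intFun [IsFiniteMeasure P] (hU : IsNormalizedUtility U)
    (hSL : IsSuperlinear U) (hC : ∀ X ∈ C, MemOrlicz (youngU U) P X)
    (hB : MemOrlicz (youngU U) P B) (hdom : ∃ X ∈ C, B + X ∈ utilDom P U) {r ε : ℝ} (hε : 0 < ε)
    (h : ∀ Y ∈ polarCone P U C, ∀ Z, MemHeart (youngV U) P Z → gaugeNorm (youngV U) P Z < ε →
      (r : EReal) ≤ intFun P (dualUtility U) (Y + Z) +
        ((∫ ω, (Y ω + Z ω) * B ω ∂P : ℝ) : EReal)) :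
    ∃ X ∈ bipolarCone P U C, (r : EReal) ≤ intFun P U (B + X) := by
  have hUu := hU.toIsUtility
  obtain ⟨X₀, hX₀, -, hX₀U⟩ := hdom
  obtain ⟨a, -, ha⟩ := EReal.lt_iff_exists_real_btwn.1 (bot_lt_iff_ne_bot.2 hX₀U)
  obtain ⟨C₀, hC₀, hpair⟩ := exists_pairing_bound hUu (hC X₀ hX₀)
  -- the bound `r` near the origin and weak duality with `X₀` elsewhere give a global bound
  have hlow : ∀ q ∈ dualEpigraph P U C B,
      r - (C₀ + |r - a| / ε) * luxemburg P U q.1 ≤ q.2 := by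
    rintro ⟨Z, t⟩ ⟨Y, hY, D, hD, hmaj, ht⟩
    have hdual := intFun_dualUtility_le hU (W := Y + (Z : Ω → ℝ)) hD hmaj
    have hp : 0 ≤ luxemburg P U Z := apply_nonneg _ _
    have hd : 0 ≤ |r - a| / ε := by positivity
    simp only at ht ⊢
    rcases lt_or_ge (luxemburg P U Z) ε with hZ | hZ
    · have h1 := (h Y hY Z Z.2 (luxemburg_eq Z ▸ hZ)).trans (add_le_add_left hdual _)
      rw [← EReal.coe_add, EReal.coe_le_coe_iff] at h1
      nlinarith
    · have h1 := ha.le.trans (intFun_le_dual_add_pairing hU hC hB hX₀ hY Z.2)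
      have h1 := h1.trans (add_le_add_left (add_le_add_left hdual _) _)
      rw [← EReal.coe_add, ← EReal.coe_add, EReal.coe_le_coe_iff] at h1
      have h2 := (le_abs_self _).trans (hpair Z)
      have h3 : |r - a| ≤ |r - a| / ε * luxemburg P U Z := by
        rw [div_mul_eq_mul_div, le_div_iff₀ hε]
        gcongr
      have := le_abs_self (r - a)
      linarith
  obtain ⟨f, C₁, hC₁, hf, hfA⟩ := (luxemburg P U).exists_affine_minorant
    (convex_dualEpigraph hUu hC hB) (by positivity) hlow
  obtain ⟨X, hX, hfX⟩ := exists_memOrlicz_of_bounded hU hSL (f := -f) hC₁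
    (fun Z => by simpa using hf Z)
  have key : ∀ Y ∈ polarCone P U C, ∀ W D : Ω → ℝ, MemHeart (youngV U) P W → Integrable D P →
      (∀ ω z, U z ≤ (D ω + W ω * z : ℝ)) →
      r + ∫ ω, X ω * Y ω ∂P ≤ ∫ ω, D ω ∂P + ∫ ω, W ω * (B + X) ω ∂P := by
    intro Y hY W D hW hD hmaj
    -- the perturbation that makes the perturbed dual variable `Y + Z` equal to `W`
    set Z : orliczHeart P U := ⟨W, hW⟩ - ⟨Y, hY.1⟩ with hZ
    have hYZ : ∀ ω, Y ω + (Z : Ω → ℝ) ω = W ω := fun ω => by simp [hZ]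
    have h1 := hfA (Z, ∫ ω, D ω ∂P + ∫ ω, W ω * B ω ∂P)
      ⟨Y, hY, D, hD, ae_of_all _ fun ω z => by simp only [hYZ]; exact hmaj ω z,
        by simp only [hYZ, le_refl]⟩
    have h2 := hfX Z
    have hi1 : Integrable (fun ω => W ω * B ω) P := by
      simpa only [mul_comm] using integrable_mul_of_memOrlicz hUu hB hW
    have hi2 := integrable_mul_of_memOrlicz hUu hX hW
    have hi3 := integrable_mul_of_memOrlicz hUu hX hY.1
    have e1 : ∫ ω, X ω * (Z : Ω → ℝ) ω ∂P = ∫ ω, X ω * W ω ∂P - ∫ ω, X ω * Y ω ∂P := by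
      rw [← integral_sub hi2 hi3]
      congr 1; funext ω
      rw [← hYZ ω]; ring
    have e2 : ∫ ω, W ω * (B + X) ω ∂P = ∫ ω, W ω * B ω ∂P + ∫ ω, X ω * W ω ∂P := by
      rw [← integral_add hi1 hi2]
      congr 1; funext ω
      simp only [Pi.add_apply]; ring
    simp only [LinearMap.neg_apply] at h2
    simp only at h1
    linarith
  obtain ⟨y₀, c₀, hmaj₀⟩ := exists_affine_majorant hU
  refine ⟨X, ⟨hX, fun Y hY => ?_⟩, ?_⟩
  · -- a linear function bounded above on a cone is nonpositive there
    by_contra! hpos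
    set m := ∫ ω, c₀ ∂P + ∫ ω, y₀ * (B + X) ω ∂P - r
    obtain ⟨n, hn⟩ := exists_nat_gt (m / ∫ ω, X ω * Y ω ∂P)
    rw [div_lt_iff₀ hpos] at hn
    have h1 := key _ (smul_mem_polarCone hY n.cast_nonneg) (fun _ => y₀) (fun _ => c₀)
      (memHeart_of_bound hSL aemeasurable_const (fun _ => le_rfl)) (integrable_const _)
      fun _ => hmaj₀
    simp only [Pi.smul_apply, smul_eq_mul, mul_left_comm _ (n : ℝ)] at h1
    rw [integral_const_mul] at h1
    linarith
  · have hBX : Integrable (B + X) P := by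
      have := integrable_mul_of_memOrlicz (Y := fun _ => 1) hUu (hB.add hUu hX)
        (memHeart_of_bound hSL aemeasurable_const (fun _ => le_rfl))
      simpa only [mul_one] using! this
    refine le_intFun_of_forall_majorant hU hBX ?_
    rintro W D hW hD ⟨M, hM⟩ hmaj
    have hDi : Integrable D P :=
      Integrable.of_bound hD.aestronglyMeasurable M (ae_of_all _ fun ω => (hM ω).2)
    have hWi : Integrable (fun ω => W ω * (B + X) ω) P :=
      hBX.bdd_mul hW.aestronglyMeasurable (ae_of_all _ fun ω => (hM ω).1)
    have h1 := key 0 zero_mem_polarCone W D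
      (memHeart_of_bound hSL hW.aemeasurable fun ω => (hM ω).1) hDi hmaj
    rw [integral_add hDi hWi]
    simpa using h1

/-- Strong duality with vanishing perturbations, for an arbitrary set of claims whose bipolar cone
yields the same maximal expected utility. -/
theorem exists_dual_sequence [IsFiniteMeasure P] (hU : IsNormalizedUtility U)
    (hSL : IsSuperlinear U) (hC : ∀ X ∈ C, MemOrlicz (youngU U) P X)
    (hB : MemOrlicz (youngU U) P B) (hdom : ∃ X ∈ C, B + X ∈ utilDom P U)
    (hgap : maxUtility P U C B = maxUtility P U (bipolarCone P U C) B) :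
    ∃ Z Y : ℕ → Ω → ℝ,
      (∀ n, MemHeart (youngV U) P (Z n)) ∧
      Tendsto (fun n => gaugeNorm (youngV U) P (Z n)) atTop (𝓝 0) ∧
      (∀ n, Y n ∈ polarCone P U C) ∧
      Tendsto
        (fun n => intFun P (dualUtility U) (Y n + Z n) +
          ((∫ ω, (Y n ω + Z n ω) * B ω ∂P : ℝ) : EReal))
        atTop (𝓝 (maxUtility P U C B)) := by
  have hgauge0 : gaugeNorm (youngV U) P 0 = 0 := by
    have := luxemburg_eq (0 : orliczHeart P U)
    rw [map_zero] at this
    exact this.symm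
  have hne : maxUtility P U C B ≠ ⊥ := by
    obtain ⟨X₀, hX₀, -, hX₀U⟩ := hdom
    exact ne_bot_of_le_ne_bot hX₀U (le_iSup₂ (f := fun X _ => intFun P U (B + X)) X₀ hX₀)
  have step : ∀ n : ℕ, ∃ Z Y : Ω → ℝ, MemHeart (youngV U) P Z ∧
      gaugeNorm (youngV U) P Z < 1 / ((n : ℝ) + 1) ∧ Y ∈ polarCone P U C ∧
      intFun P (dualUtility U) (Y + Z) + ((∫ ω, (Y ω + Z ω) * B ω ∂P : ℝ) : EReal) ≤
        maxUtility P U C B + ((1 / ((n : ℝ) + 1) : ℝ) : EReal) := by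
    intro n
    have hn : 0 < 1 / ((n : ℝ) + 1) := by positivity
    by_cases htop : maxUtility P U C B = ⊤
    · refine ⟨0, 0, (orliczHeart P U).zero_mem, by rw [hgauge0]; exact hn, zero_mem_polarCone, ?_⟩
      rw [htop, EReal.top_add_coe]
      exact le_top
    · lift maxUtility P U C B to ℝ using ⟨htop, hne⟩ with u hu
      by_contra! hcon
      obtain ⟨X, hX, hXr⟩ := exists_bipolar_le_intFun hU hSL hC hB hdom
        (r := u + 1 / ((n : ℝ) + 1)) hn fun Y hY Z hZ hZn => by
          rw [EReal.coe_add]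
          exact (hcon Z Y hZ hZn hY).le
      have h1 := hXr.trans (le_iSup₂ (f := fun X _ => intFun P U (B + X)) X hX)
      have h2 : ((u + 1 / ((n : ℝ) + 1) : ℝ) : EReal) ≤ (u : EReal) := by
        rw [hgap]; exact h1
      rw [EReal.coe_le_coe_iff] at h2
      linarith
  choose Z Y hZ hZn hY hval using step
  have hZ0 : Tendsto (fun n => gaugeNorm (youngV U) P (Z n)) atTop (𝓝 0) :=
    squeeze_zero (fun n => by
      have := apply_nonneg (luxemburg P U) ⟨Z n, hZ n⟩
      rwa [luxemburg_eq] at this) (fun n => (hZn n).le) tendsto_one_div_add_atTop_nhds_zero_nat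
  refine ⟨Z, Y, hZ, hZ0, hY, tendsto_order.2 ⟨fun a ha => ?_, fun b hb => ?_⟩⟩
  · obtain ⟨X, hX⟩ := lt_iSup_iff.1 ha
    obtain ⟨hXC, hXa⟩ := lt_iSup_iff.1 hX
    obtain ⟨v, hav, hv⟩ := EReal.lt_iff_exists_real_btwn.1 hXa
    obtain ⟨w, haw, hw⟩ := EReal.lt_iff_exists_real_btwn.1 hav
    rw [EReal.coe_lt_coe_iff] at hw
    obtain ⟨K, -, hpair⟩ := exists_pairing_bound hU.toIsUtility (hC X hXC)
    have hδ : Tendsto (fun n => ∫ ω, X ω * Z n ω ∂P) atTop (𝓝 0) := by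
      have h1 := hZ0.const_mul K
      rw [mul_zero] at h1
      refine squeeze_zero_norm (fun n => ?_) h1
      have := hpair ⟨Z n, hZ n⟩
      rwa [luxemburg_eq] at this
    filter_upwards [hδ.eventually (gt_mem_nhds (sub_pos.2 hw))] with n hn
    refine haw.trans ?_
    by_contra! hle
    have h1 := hv.le.trans (intFun_le_dual_add_pairing hU hC hB hXC (hY n) (hZ n))
    have h1 := h1.trans (add_le_add_left hle _)
    rw [← EReal.coe_add, EReal.coe_le_coe_iff] at h1
    linarith
  · have htop : maxUtility P U C B ≠ ⊤ := hb.ne_top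
    lift maxUtility P U C B to ℝ using ⟨htop, hne⟩ with u hu
    obtain ⟨v, huv, hvb⟩ := EReal.lt_iff_exists_real_btwn.1 hb
    rw [EReal.coe_lt_coe_iff] at huv
    filter_upwards [tendsto_one_div_add_atTop_nhds_zero_nat.eventually
      (gt_mem_nhds (sub_pos.2 huv))] with n hn
    refine (hval n).trans_lt (lt_trans ?_ hvb)
    rw [← EReal.coe_add, EReal.coe_lt_coe_iff]
    linarith

end Duality

theorem proposition4p1 {Ω : Type*} {mΩ : MeasurableSpace Ω} (P : Measure Ω)
    [IsProbabilityMeasure P] {T : ℝ≥0} (ℱ : Filtration (Iic T) mΩ) (hT : ℱ ⊤ = mΩ)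
    {d : ℕ} (S : Iic T → Ω → Fin d → ℝ) (hS : ∀ i, IsSemimart P ℱ (fun t ω => S t ω i))
    (U : ℝ → EReal) (hU : IsNormalizedUtility U) (hSL : IsSuperlinear U)
    (B : Ω → ℝ) (hB : MemOrlicz (youngU U) P B)
    (hdom : ∃ X ∈ superReplicable P ℱ S U, B + X ∈ utilDom P U)
    (hgap : maxUtility P U (superReplicable P ℱ S U) B =
      maxUtility P U (bipolarCone P U (superReplicable P ℱ S U)) B) :
    ∃ Z Y : ℕ → Ω → ℝ,
      (∀ n, MemHeart (youngV U) P (Z n)) ∧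
      Tendsto (fun n => gaugeNorm (youngV U) P (Z n)) atTop (𝓝 0) ∧
      (∀ n, Y n ∈ polarCone P U (superReplicable P ℱ S U)) ∧
      Tendsto
        (fun n => intFun P (dualUtility U) (Y n + Z n) +
          ((∫ ω, (Y n ω + Z n ω) * B ω ∂P : ℝ) : EReal))
        atTop (𝓝 (maxUtility P U (superReplicable P ℱ S U) B)) := by
  exact exists_dual_sequence hU hSL (fun X hX => hX.1) hB hdom hgap
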